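/- Let $E\subset\mathbb{R}^2$ be an open simple polygon with $N_E\ge 3$ vertices $x_1,\dots,x_{N_E}$ (straight angles at vertices are allowed), outward unit normal $\boldsymbol n$ and diameter $h_E$, satisfying the usual mesh assumptions: for some $\kappa>0$, $E$ is star-shaped with respect to a ball of radius at least $\kappa h_E$ contained in $E$, and every edge of $E$ has length at least $\kappa h_E$. Let $l\ge 0$ be an integer, and let $\mathbb P_k(E)$ be the space of polynomials of total degree at most $k$ on $E$. Let $\mathrm P_0:H^1(E)\to\mathbb P_0(E)=\mathbb R$ be a continuous linear operator with $\mathrm P_0(c)=c$ for constants $c$. For $v\in H^1(E)$ let $\Pi^\nabla_1 v\in\mathbb P_1(E)$ be defined by $$(\nabla(\Pi^\nabla_1 v-v),\nabla p)_E=0\quad\forall p\in\mathbb P_1(E),\qquad \mathrm P_0(\Pi^\nabla_1 v-v)=0 .$$ Let $V_E^{1,l}$ be the set of all $v\in H^1(E)$ such that * $(v,p)_E=(\Pi_1^\nabla v,p)_E$ for all $p\in\mathbb P_{l+1}(E)$; * $\Delta v\in\mathbb P_{l+1}(E)$ in the sense of distributions; * the trace of $v$ on $\partial E$ is continuous, and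 is affine on each edge of $E$. Assume that $\mathrm P_0(v)=0$ for every $v\in V_E^{1,l}$ whose trace on $\partial E$ vanishes (equivalently, for $v\in V_E^{1,l}$ the number $\mathrm P_0(v)$ is determined by the values of $v$ at the vertices of $E$); this holds for instance if $\mathrm P_0(v)=|\partial E|^{-1}\int_{\partial E}v\,ds$. Let $$B_l(E)=\Big\{\boldsymbol p\in[\mathbb P_l(E)]^2:\ \int_{\partial E}\boldsymbol p\cdot\boldsymbol n\,\big(v-\mathrm P_0(v)\big)\,ds=0\quad\forall v\in V_E^{1,l}\Big\},$$ and suppose that $$(l+1)(l+2)-\dim B_l(E)\ \ge\ N_E-1 .$$ Let $\Pi^0_l$ be the $L^2(E)$-orthogonal projection of $[L^2(E)]^2$ onto $[\mathbb P_l(E)]^2$. Then, for every $u\in V_E^{1,l}$, $$\Pi^0_l\nabla u=0\ \Longrightarrow\ \nabla u=0\ \text{ on } E .$$ -/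

import Mathlib

open MeasureTheory Filter Topology Set
open scoped ContDiff RealInnerProductSpace

noncomputable section

namespace E2VEM

/-- The Euclidean plane. -/
abbrev Plane : Type := EuclideanSpace ℝ (Fin 2)

/-! ### Polygons -/

/-- The vertex that follows the `i`-th one in cyclic order. -/
def nextVertex {N : ℕ} (x : Fin N → Plane) (i : Fin N) : Plane := x (finRotate N i)

/-- The closed edge from the `i`-th vertex to the next one. -/
def edge {N : ℕ} (x : Fin N → Plane) (i : Fin N) : Set Plane := segment ℝ (x i) (nextVertex x i)

/-- The unit normal to the right of the directed edge `i`; it is the outward-pointing one when the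
vertices are numbered counterclockwise. -/
def normal {N : ℕ} (x : Fin N → Plane) (i : Fin N) : Plane :=
  (dist (x i) (nextVertex x i))⁻¹ •
    !₂[nextVertex x i 1 - x i 1, -(nextVertex x i 0 - x i 0)]

/-- `E` is the (open) simple polygon with vertices `x₁, …, x_N`, numbered counterclockwise.
Straight angles at vertices are allowed. -/
structure IsPolygon {N : ℕ} (x : Fin N → Plane) (E : Set Plane) : Prop where
  three_le : 3 ≤ N
  isOpen : IsOpen E
  isBounded : Bornology.IsBounded E
  /-- The boundary is the union of the edges. -/
  frontier_eq : frontier E = ⋃ i, edge x i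
  /-- The closed polygonal line does not intersect itself. -/
  simple : InjOn (fun s : Fin N × ℝ => AffineMap.lineMap (x s.1) (nextVertex x s.1) s.2)
    (univ ×ˢ Ico (0 : ℝ) 1)
  /-- Counterclockwise numbering: `E` lies to the left of each of its directed edges. -/
  counterclockwise : ∀ i, ∀ t ∈ Ioo (0 : ℝ) 1, ∀ᶠ ε in 𝓝[>] (0 : ℝ),
    AffineMap.lineMap (x i) (nextVertex x i) t - ε • normal x i ∈ E

/-- The mesh assumptions on an element `E` with regularity parameter `κ`: star-shapedness with
respect to a ball of radius at least `κ h_E`, and edges of length at least `κ h_E`. -/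
structure IsRegular {N : ℕ} (κ : ℝ) (x : Fin N → Plane) (E : Set Plane) : Prop where
  starShaped : ∃ (c : Plane) (ρ : ℝ), 0 < ρ ∧ κ * Metric.diam E ≤ ρ ∧
    Metric.ball c ρ ⊆ E ∧ ∀ y ∈ Metric.ball c ρ, StarConvex ℝ y E
  edge_length : ∀ i, κ * Metric.diam E ≤ dist (x i) (nextVertex x i)

/-- Arc length on the edge `i`. -/
def edgeMeasure {N : ℕ} (x : Fin N → Plane) (i : Fin N) : Measure Plane :=
  ENNReal.ofReal (dist (x i) (nextVertex x i)) •
    (volume.restrict (Icc (0 : ℝ) 1)).map (fun t => AffineMap.lineMap (x i) (nextVertex x i) t)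

/-- Arc length on the boundary of the polygon. -/
def boundaryMeasure {N : ℕ} (x : Fin N → Plane) : Measure Plane := ∑ i, edgeMeasure x i

/-! ### Polynomials -/

/-- Real polynomials in two variables of total degree at most `k`. -/
abbrev Poly (k : ℕ) : Submodule ℝ (MvPolynomial (Fin 2) ℝ) :=
  MvPolynomial.restrictTotalDegree (Fin 2) ℝ k

/-- The function on the plane given by a polynomial. -/
def polyFun (p : MvPolynomial (Fin 2) ℝ) (x : Plane) : ℝ := MvPolynomial.eval x.ofLp p

/-- The vector field on the plane given by a pair of polynomials of degree at most `l`. -/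
def polyField {l : ℕ} (p : Fin 2 → Poly l) (x : Plane) : Plane :=
  WithLp.toLp 2 (fun i => polyFun (p i) x)

/-! ### The Sobolev space `H¹(E)` -/

/-- `G` is the weak gradient of `v` on `E`. -/
def IsWeakGradient (E : Set Plane) (v : Plane → ℝ) (G : Plane → Plane) : Prop :=
  ∀ φ : Plane → ℝ, ContDiff ℝ ∞ φ → HasCompactSupport φ → tsupport φ ⊆ E →
    ∫ y in E, v y • gradient φ y = -∫ y in E, φ y • G y

/-- `L²(E)`. -/
abbrev L2 (E : Set Plane) : Type := Lp ℝ 2 (volume.restrict E)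

/-- `[L²(E)]²`. -/
abbrev L2Vec (E : Set Plane) : Type := Lp Plane 2 (volume.restrict E)

lemma integrable_smul_of_test {F : Type*} [NormedAddCommGroup F] [NormedSpace ℝ F]
    {E : Set Plane} {v : Plane → ℝ} {G : Plane → F}
    (hv : MemLp v 2 (volume.restrict E)) (hG : MemLp G 2 (volume.restrict E)) :
    Integrable (fun y => v y • G y) (volume.restrict E) :=
  memLp_one_iff_integrable.mp (hG.smul hv)

lemma memLp_test {φ : Plane → ℝ} (h : ContDiff ℝ ∞ φ) (hc : HasCompactSupport φ) (E : Set Plane) :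
    MemLp φ 2 (volume.restrict E) :=
  (h.continuous.memLp_of_hasCompactSupport hc).restrict E

lemma continuous_gradient {φ : Plane → ℝ} (h : ContDiff ℝ ∞ φ) : Continuous (gradient φ) :=
  (InnerProductSpace.toDual ℝ Plane).symm.continuous.comp (h.continuous_fderiv (by simp))

lemma memLp_gradient_test {φ : Plane → ℝ} (h : ContDiff ℝ ∞ φ) (hc : HasCompactSupport φ)
    (E : Set Plane) : MemLp (gradient φ) 2 (volume.restrict E) := by
  have hc' : HasCompactSupport (gradient φ) :=
    (hc.fderiv ℝ).comp_left (g := (InnerProductSpace.toDual ℝ Plane).symm) (map_zero _)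
  exact ((continuous_gradient h).memLp_of_hasCompactSupport hc').restrict E

/-- `H¹(E)`: pairs of a function in `L²(E)` and its weak gradient in `[L²(E)]²`, with the topology
of the graph norm. -/
def H1 (E : Set Plane) : Submodule ℝ (L2 E × L2Vec E) where
  carrier := {w | IsWeakGradient E w.1 w.2}
  zero_mem' := by
    intro φ hφ hc hs
    have h1 : ∫ y in E, ((0 : L2 E) : Plane → ℝ) y • gradient φ y = 0 := by
      rw [← integral_zero Plane Plane (μ := volume.restrict E)]
      apply integral_congr_ae
      filter_upwards [Lp.coeFn_zero ℝ 2 (volume.restrict E)] with y hy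
      rw [hy]; simp
    have h2 : ∫ y in E, φ y • ((0 : L2Vec E) : Plane → Plane) y = 0 := by
      rw [← integral_zero Plane Plane (μ := volume.restrict E)]
      apply integral_congr_ae
      filter_upwards [Lp.coeFn_zero Plane 2 (volume.restrict E)] with y hy
      rw [hy]; simp
    exact h1.trans (by rw [neg_eq_zero.mpr]; exact h2)
  add_mem' := by
    intro a b ha hb φ hφ hc hs
    have h1 : ∫ y in E, ((a + b).1 : Plane → ℝ) y • gradient φ y =
        (∫ y in E, (a.1 : Plane → ℝ) y • gradient φ y) +
          ∫ y in E, (b.1 : Plane → ℝ) y • gradient φ y := by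
      rw [← integral_add (integrable_smul_of_test (Lp.memLp a.1) (memLp_gradient_test hφ hc E))
        (integrable_smul_of_test (Lp.memLp b.1) (memLp_gradient_test hφ hc E))]
      apply integral_congr_ae
      filter_upwards [Lp.coeFn_add a.1 b.1] with y hy
      rw [Prod.fst_add, hy, Pi.add_apply, add_smul]
    have h2 : ∫ y in E, φ y • ((a + b).2 : Plane → Plane) y =
        (∫ y in E, φ y • (a.2 : Plane → Plane) y) +
          ∫ y in E, φ y • (b.2 : Plane → Plane) y := by
      rw [← integral_add (integrable_smul_of_test (memLp_test hφ hc E) (Lp.memLp a.2))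
        (integrable_smul_of_test (memLp_test hφ hc E) (Lp.memLp b.2))]
      apply integral_congr_ae
      filter_upwards [Lp.coeFn_add a.2 b.2] with y hy
      rw [Prod.snd_add, hy, Pi.add_apply, smul_add]
    rw [h1, h2, ha φ hφ hc hs, hb φ hφ hc hs]
    abel
  smul_mem' := by
    intro c a ha φ hφ hc hs
    have h1 : ∫ y in E, ((c • a).1 : Plane → ℝ) y • gradient φ y =
        c • ∫ y in E, (a.1 : Plane → ℝ) y • gradient φ y := by
      rw [← integral_smul]
      apply integral_congr_ae
      filter_upwards [Lp.coeFn_smul c a.1] with y hy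
      rw [Prod.smul_fst, hy, Pi.smul_apply, smul_assoc]
    have h2 : ∫ y in E, φ y • ((c • a).2 : Plane → Plane) y =
        c • ∫ y in E, φ y • (a.2 : Plane → Plane) y := by
      rw [← integral_smul]
      apply integral_congr_ae
      filter_upwards [Lp.coeFn_smul c a.2] with y hy
      rw [Prod.smul_snd, hy, Pi.smul_apply, smul_comm]
    rw [h1, h2, ha φ hφ hc hs, smul_neg]

/-- The `L²` function underlying an element of `H¹(E)`. -/
def fn {E : Set Plane} (v : H1 E) : L2 E := v.1.1

/-- The weak gradient of an element of `H¹(E)`. -/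
def grad {E : Set Plane} (v : H1 E) : L2Vec E := v.1.2

/-- `w` is (the restriction to `E` of) a polynomial of degree at most `k`. -/
def IsPoly {E : Set Plane} (k : ℕ) (w : H1 E) : Prop :=
  ∃ p ∈ Poly k, (fn w : Plane → ℝ) =ᵐ[volume.restrict E] polyFun p

/-- `g` is the trace of `v` on `∂E`, in `L²(∂E)`: the trace operator is the closure of the
restriction to `∂E` of functions that are smooth up to the boundary. -/
def IsTrace {N : ℕ} (x : Fin N → Plane) {E : Set Plane} (v : H1 E) (g : Plane → ℝ) : Prop :=
  MemLp g 2 (boundaryMeasure x) ∧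
  ∃ f : ℕ → Plane → ℝ, (∀ n, ContDiff ℝ ∞ (f n)) ∧
    Tendsto (fun n => eLpNorm (fun y => f n y - fn v y) 2 (volume.restrict E)) atTop (𝓝 0) ∧
    Tendsto (fun n => eLpNorm (fun y => gradient (f n) y - grad v y) 2 (volume.restrict E))
      atTop (𝓝 0) ∧
    Tendsto (fun n => eLpNorm (fun y => f n y - g y) 2 (boundaryMeasure x)) atTop (𝓝 0)

/-- `Δ v = q` on `E` in the sense of distributions. -/
def HasWeakLaplacian {E : Set Plane} (v : H1 E) (q : Plane → ℝ) : Prop :=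
  ∀ φ : Plane → ℝ, ContDiff ℝ ∞ φ → HasCompactSupport φ → tsupport φ ⊆ E →
    ∫ y in E, ⟪grad v y, gradient φ y⟫ = -∫ y in E, q y * φ y

/-! ### Projections and the virtual element space -/

/-- A continuous linear operator `P₀ : H¹(E) → ℙ₀(E) = ℝ` is a projection if it fixes the
constants. -/
def IsConstProjection {E : Set Plane} (P₀ : H1 E →L[ℝ] ℝ) : Prop :=
  ∀ (c : ℝ) (w : H1 E), (fn w : Plane → ℝ) =ᵐ[volume.restrict E] (fun _ => c) → P₀ w = c

/-- `w = Π^∇₁ v`: `w` is an affine polynomial with `(∇(w - v), ∇p)_E = 0` for all affine `p`, and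
`P₀ (w - v) = 0`. -/
def IsPiNabla {E : Set Plane} (P₀ : H1 E →L[ℝ] ℝ) (v w : H1 E) : Prop :=
  IsPoly 1 w ∧ (∀ p : H1 E, IsPoly 1 p → ⟪grad (w - v), grad p⟫ = 0) ∧ P₀ (w - v) = 0

/-- The functions with the enlarged enhancement property:
`(v, p)_E = (Π^∇₁ v, p)_E` for all polynomials `p` of degree at most `l + 1`. -/
def enhanced {E : Set Plane} (P₀ : H1 E →L[ℝ] ℝ) (l : ℕ) : Set (H1 E) :=
  {v | ∃ w, IsPiNabla P₀ v w ∧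
    ∀ p ∈ Poly (l + 1), ∫ y in E, fn v y * polyFun p y = ∫ y in E, fn w y * polyFun p y}

/-- The Enlarged Enhancement Virtual Element space of order one: enhanced functions with Laplacian
in `ℙ_{l+1}(E)` and trace continuous on `∂E` and affine on each edge. -/
def virtualSpace {N : ℕ} (x : Fin N → Plane) {E : Set Plane} (P₀ : H1 E →L[ℝ] ℝ) (l : ℕ) :
    Set (H1 E) :=
  {v | v ∈ enhanced P₀ l ∧ (∃ q ∈ Poly (l + 1), HasWeakLaplacian v (polyFun q)) ∧
    ∃ g : Plane → ℝ, IsTrace x v g ∧ ContinuousOn g (frontier E) ∧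
      ∀ i, ∃ p ∈ Poly 1, EqOn g (polyFun p) (edge x i)}

lemma continuous_polyFun (p : MvPolynomial (Fin 2) ℝ) : Continuous (polyFun p) :=
  (MvPolynomial.continuous_eval p).comp (PiLp.continuous_ofLp 2 _)

lemma continuous_polyField {l : ℕ} (p : Fin 2 → Poly l) : Continuous (polyField p) :=
  (PiLp.continuous_toLp 2 _).comp (continuous_pi fun i => continuous_polyFun (p i))

lemma polyField_add {l : ℕ} (p q : Fin 2 → Poly l) :
    polyField (p + q) = polyField p + polyField q := by
  ext y i; simp [polyField, polyFun]

lemma polyField_smul {l : ℕ} (c : ℝ) (p : Fin 2 → Poly l) :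
    polyField (c • p) = c • polyField p := by
  ext y i; simp [polyField, polyFun, MvPolynomial.smul_eval]

lemma polyField_zero {l : ℕ} : polyField (0 : Fin 2 → Poly l) = 0 := by
  ext y i; simp [polyField, polyFun]

lemma integrable_edge {N : ℕ} (x : Fin N → Plane) {l : ℕ} (p : Fin 2 → Poly l) {g : Plane → ℝ}
    (hg : MemLp g 2 (boundaryMeasure x)) (c : ℝ) (i : Fin N) :
    Integrable (fun y => ⟪polyField p y, normal x i⟫ * (g y - c)) (edgeMeasure x i) := by
  have hline : Continuous (fun t : ℝ => (AffineMap.lineMap (x i) (nextVertex x i) t : Plane)) :=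
    AffineMap.lineMap_continuous
  have hfin : IsFiniteMeasure (edgeMeasure x i) := by
    unfold edgeMeasure
    have : IsFiniteMeasure ((volume.restrict (Icc (0 : ℝ) 1)).map
      (fun t => (AffineMap.lineMap (x i) (nextVertex x i) t : Plane))) :=
        Measure.isFiniteMeasure_map _ _
    exact Measure.smul_finite _ ENNReal.ofReal_ne_top
  have hle : edgeMeasure x i ≤ boundaryMeasure x := by
    rw [boundaryMeasure, ← Finset.sum_erase_add _ _ (Finset.mem_univ i)]
    exact Measure.le_add_left le_rfl
  have hg1 : Integrable (fun y => g y - c) (edgeMeasure x i) :=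
    ((hg.mono_measure hle).integrable (by norm_num)).sub (integrable_const c)
  have hcont : Continuous fun y => ⟪polyField p y, normal x i⟫ :=
    (continuous_polyField p).inner continuous_const
  obtain ⟨C, hC⟩ := (isCompact_Icc (a := (0 : ℝ)) (b := 1)).exists_bound_of_continuousOn
    (hcont.comp hline).continuousOn
  refine hg1.bdd_mul (c := C) hcont.aestronglyMeasurable ?_
  unfold edgeMeasure
  refine Measure.ae_smul_measure ?_ _
  rw [ae_map_iff hline.aemeasurable
    (isClosed_le hcont.norm continuous_const).measurableSet]
  exact ae_restrict_of_forall_mem measurableSet_Icc hC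

/-- The pairs of polynomials `p ∈ [ℙ_l(E)]²` with `∫_{∂E} p·n (v - P₀ v) = 0` for all `v` in the
virtual element space. -/
def badPoly {N : ℕ} (x : Fin N → Plane) {E : Set Plane} (P₀ : H1 E →L[ℝ] ℝ) (l : ℕ) :
    Submodule ℝ (Fin 2 → Poly l) where
  carrier := {p | ∀ v ∈ virtualSpace x P₀ l, ∀ g, IsTrace x v g →
    ∑ i, ∫ y, ⟪polyField p y, normal x i⟫ * (g y - P₀ v) ∂(edgeMeasure x i) = 0}
  zero_mem' := by
    intro v _ g _
    simp [polyField_zero]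
  add_mem' := by
    intro p q hp hq v hv g hg
    have := congrArg₂ (· + ·) (hp v hv g hg) (hq v hv g hg)
    simp only [← Finset.sum_add_distrib, add_zero] at this
    rw [← this]
    refine Finset.sum_congr rfl fun i _ => ?_
    refine Eq.trans ?_
      (integral_add (integrable_edge x p hg.1 _ i) (integrable_edge x q hg.1 _ i))
    refine integral_congr_ae (Eventually.of_forall fun y => ?_)
    simp [polyField_add, inner_add_left, add_mul]
  smul_mem' := by
    intro c p hp v hv g hg
    have := congrArg (c * ·) (hp v hv g hg)
    simp only [Finset.mul_sum, mul_zero] at this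
    rw [← this]
    refine Finset.sum_congr rfl fun i _ => ?_
    rw [← integral_const_mul]
    refine integral_congr_ae (Eventually.of_forall fun y => ?_)
    simp [polyField_smul, real_inner_smul_left, mul_assoc]

/-- `[ℙ_l(E)]²` as a subspace of `[L²(E)]²`. -/
def polyL2 (E : Set Plane) (l : ℕ) : Submodule ℝ (L2Vec E) where
  carrier := {F | ∃ p : Fin 2 → Poly l, (F : Plane → Plane) =ᵐ[volume.restrict E] polyField p}
  zero_mem' := ⟨0, by rw [polyField_zero]; exact Lp.coeFn_zero _ _ _⟩
  add_mem' := by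
    rintro F G ⟨p, hp⟩ ⟨q, hq⟩
    exact ⟨p + q, by rw [polyField_add]; exact (Lp.coeFn_add F G).trans (hp.add hq)⟩
  smul_mem' := by
    rintro c F ⟨p, hp⟩
    exact ⟨c • p, by rw [polyField_smul]; exact (Lp.coeFn_smul c F).trans (hp.const_smul c)⟩

instance finiteDimensional_poly (l : ℕ) : FiniteDimensional ℝ (Poly l) := by
  infer_instance

instance finiteDimensional_polyL2 (E : Set Plane) (l : ℕ) :
    FiniteDimensional ℝ (polyL2 E l) := by
  let S : Submodule ℝ (Fin 2 → Poly l) :=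
    { carrier := {p | MemLp (polyField p) 2 (volume.restrict E)}
      zero_mem' := by simp [polyField_zero]
      add_mem' := by
        intro p q hp hq
        simpa [polyField_add] using MemLp.add hp hq
      smul_mem' := by
        intro c p hp
        simpa [polyField_smul] using MemLp.const_smul hp c }
  let T : S →ₗ[ℝ] L2Vec E :=
    { toFun := fun p => MemLp.toLp (polyField p.1) p.2
      map_add' := by
        intro p q
        rw [← MemLp.toLp_add]
        exact MemLp.toLp_congr _ _ (by simp [polyField_add])
      map_smul' := by
        intro c p
        rw [RingHom.id_apply, ← MemLp.toLp_const_smul]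
        exact MemLp.toLp_congr _ _ (by simp [polyField_smul]) }
  refine Submodule.finiteDimensional_of_le (S₂ := LinearMap.range T) ?_
  rintro F ⟨p, hp⟩
  have hm : MemLp (polyField p) 2 (volume.restrict E) := (memLp_congr_ae hp).mp (Lp.memLp F)
  exact ⟨⟨p, hm⟩, Lp.ext ((MemLp.coeFn_toLp hm).trans hp.symm)⟩

/-- The `L²(E)`-orthogonal projection `Π⁰_l` of a vector field onto `[ℙ_l(E)]²`. -/
def piZero {E : Set Plane} (l : ℕ) (F : L2Vec E) : L2Vec E := (polyL2 E l).starProjection F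

end E2VEM

end

/-! Suppose `Π⁰_l ∇u = 0` and put `w = u - P₀ u`. The affine function `Π^∇₁ w` has constant
gradient, a field in `[ℙ_l]²`, so testing its definition with itself gives `‖∇Π^∇₁ w‖² = (∇w, ∇Π^∇₁
w) = 0`. Hence `Π^∇₁ w` is a constant, and this constant is `P₀ w = 0`. The enhancement property
then makes `w` orthogonal to all of `ℙ_{l+1}` (`integral_mul_polyFun_eq_zero`).

This orthogonality is used twice. First, for `p ∈ [ℙ_l]²` Green's formula writes the flux `∫_{∂E}
p·n (u - P₀ u)` as `(∇w, p) + (w, div p)`, and both terms vanish (`fluxForm_eq_zero`). The flux of a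
virtual function depends only on its `N` vertex values, because zero vertex values force a zero
trace and then `P₀ v = 0`. The common kernel of the fluxes lies in `B_l`, so by the dimension
hypothesis they span at least `N - 1` dimensions. At most one direction of vertex values is
therefore invisible to the flux, and `(1, …, 1)` is such a direction: the vertex values of `u` are
all equal to some `d` (`exists_smul_of_functional_eq_zero`, `exists_vertexValues_eq`).

Second, `u - d` has zero trace, hence `P₀ (u - d) = 0`, and the same orthogonality applies to it.
Since its Laplacian is in `ℙ_{l+1}`, Green's formula gives `‖∇u‖² = -(Δ(u - d), u - d) = 0`
(`grad_eq_zero_of_trace_zero`).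

The analytic work lies in the two Green formulas. `integral_fderiv_polygon` cuts the star-shaped
polygon into triangles with apex at its centre; `IsTrace.green` passes from smooth functions to
`H¹(E)` by density. The formula with the Laplacian, `integral_grad_sq_of_trace_zero`, needs test
functions approximating `v`: the extension of `v` by zero is shrunk towards the centre, which moves
its support inside `E`, and then mollified. -/

noncomputable section

namespace E2VEM

/-! ### The gradient theorem on a polygon -/

/-- The two-dimensional cross product. -/
def cross (a b : Plane) : ℝ := a 0 * b 1 - a 1 * b 0

/-- The parametrization of the triangle `c a b` by the radial coordinate from `c` and the position
on the side `a b`. -/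
def radial (c a b : Plane) (p : ℝ × ℝ) : Plane := c + p.1 • (AffineMap.lineMap a b p.2 - c)

/-- The coordinates of a point of the plane, as a pair. -/
def planePair : Plane ≃ᵐ ℝ × ℝ :=
  (MeasurableEquiv.toLp 2 (Fin 2 → ℝ)).symm.trans MeasurableEquiv.finTwoArrow

lemma planePair_apply (z : Plane) : planePair z = (z 0, z 1) := rfl

lemma measurePreserving_planePair : MeasurePreserving planePair volume volume :=
  (volume_preserving_finTwoArrow ℝ).comp (EuclideanSpace.volume_preserving_symm_measurableEquiv_toLp (Fin 2))

lemma continuous_radial (c a b : Plane) : Continuous (radial c a b) := by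
  unfold radial
  simp only [AffineMap.lineMap_apply_module]
  fun_prop

/-- The derivative of `radial`, in the variables of the plane. -/
def radialDeriv (c a b : Plane) (p : ℝ × ℝ) : Plane →L[ℝ] Plane :=
  (EuclideanSpace.proj 0 : Plane →L[ℝ] ℝ).smulRight (AffineMap.lineMap a b p.2 - c) +
    (EuclideanSpace.proj 1 : Plane →L[ℝ] ℝ).smulRight (p.1 • (b - a))

/-- Sliding along the side adds a multiple of `b - a` to `a - c`, which does not change the cross
product with `b - a`; so the Jacobian depends on the radial coordinate alone. -/
lemma det_radialDeriv (c a b : Plane) (p : ℝ × ℝ) :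
    (radialDeriv c a b p).det = p.1 * cross (a - c) (b - a) := by
  rw [ContinuousLinearMap.det,
    ← LinearMap.det_toMatrix (EuclideanSpace.basisFun (Fin 2) ℝ).toBasis, Matrix.det_fin_two]
  simp [LinearMap.toMatrix_apply, radialDeriv, AffineMap.lineMap_apply_module, cross]
  ring

lemma hasFDerivAt_radial (c a b : Plane) (z : Plane) :
    HasFDerivAt (fun z => radial c a b (planePair z)) (radialDeriv c a b (planePair z)) z := by
  have h0 : HasFDerivAt (fun z : Plane => z 0) (EuclideanSpace.proj 0 : Plane →L[ℝ] ℝ) z :=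
    (EuclideanSpace.proj 0 : Plane →L[ℝ] ℝ).hasFDerivAt
  have h1 : HasFDerivAt (fun z : Plane => z 1) (EuclideanSpace.proj 1 : Plane →L[ℝ] ℝ) z :=
    (EuclideanSpace.proj 1 : Plane →L[ℝ] ℝ).hasFDerivAt
  have h2 : HasFDerivAt (fun z : Plane => AffineMap.lineMap a b (z 1) - c)
      ((EuclideanSpace.proj 1 : Plane →L[ℝ] ℝ).smulRight (b - a)) z := by
    simp only [AffineMap.lineMap_apply, vsub_eq_sub, vadd_eq_add]
    exact ((h1.smul_const (b - a)).add_const a).sub_const c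
  refine ((h0.smul h2).const_add c).congr_fderiv ?_
  ext w i
  simp [radialDeriv, planePair_apply]
  ring

/-- The determinant is that of a map from the plane to itself, so the parameter square is first
carried to the plane by the measure-preserving `planePair`. -/
lemma integral_radial_image {c a b : Plane} {S : Set (ℝ × ℝ)} (hS : MeasurableSet S)
    (hinj : InjOn (radial c a b) S) (g : Plane → ℝ) :
    ∫ y in radial c a b '' S, g y =
      ∫ p in S, |p.1 * cross (a - c) (b - a)| * g (radial c a b p) := by
  have himg : radial c a b '' S = (fun z => radial c a b (planePair z)) '' (planePair ⁻¹' S) := by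
    rw [← Function.comp_def, image_comp, image_preimage_eq _ planePair.surjective]
  rw [himg, integral_image_eq_integral_abs_det_fderiv_smul volume (planePair.measurable hS)
    (fun z _ => (hasFDerivAt_radial c a b z).hasFDerivWithinAt)
    (fun z hz w hw h => planePair.injective (hinj hz hw h)),
    ← measurePreserving_planePair.setIntegral_preimage_emb planePair.measurableEmbedding]
  simp only [det_radialDeriv, smul_eq_mul]

/-- Cramer's rule in the plane. In `integral_triangle` it recombines the radial and tangential
derivatives into the derivative along `v`. -/
lemma cross_identity (v a b : Plane) : cross v b • a - cross v a • b = cross a b • v := by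
  ext i; fin_cases i <;> simp [cross] <;> ring

/-- The divergence theorem on a triangle, in radial coordinates. -/
lemma integral_triangle {f : Plane → ℝ} (hf : ContDiff ℝ 1 f) (c a b v : Plane) :
    ∫ p in Icc (0 : ℝ × ℝ) 1, p.1 * cross (a - c) (b - a) * fderiv ℝ f (radial c a b p) v =
      (cross v (b - a) * ∫ t in (0 : ℝ)..1, f (AffineMap.lineMap a b t)) +
      ((∫ s in (0 : ℝ)..1, cross v (a - c) * f (c + s • (a - c))) -
        ∫ s in (0 : ℝ)..1, cross v (b - c) * f (c + s • (b - c))) := by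
  have hfd : ∀ y, HasFDerivAt f (fderiv ℝ f y) y := fun y =>
    (hf.differentiable (by simp)).differentiableAt.hasFDerivAt
  have hline : ∀ p : ℝ × ℝ, HasFDerivAt (fun p : ℝ × ℝ => AffineMap.lineMap a b p.2 - c)
      ((ContinuousLinearMap.snd ℝ ℝ ℝ).smulRight (b - a)) p := by
    intro p
    simp only [AffineMap.lineMap_apply, vsub_eq_sub, vadd_eq_add]
    exact ((hasFDerivAt_snd.smul_const (b - a)).add_const a).sub_const c
  have hrad : ∀ p : ℝ × ℝ, HasFDerivAt (radial c a b)
      (p.1 • (ContinuousLinearMap.snd ℝ ℝ ℝ).smulRight (b - a) +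
        (ContinuousLinearMap.fst ℝ ℝ ℝ).smulRight (AffineMap.lineMap a b p.2 - c)) p := fun p =>
    ((hasFDerivAt_fst (p := p)).smul (hline p)).const_add c
  -- The field on the square has components `s f × (v ∧ (b - a))` and `-f × (v ∧ (ℓ(t) - c))`, where
  -- `ℓ` parametrizes the side. In its divergence the terms without a derivative of `f` cancel, and
  -- `cross_identity` handles the others.
  let Lc : Plane →L[ℝ] ℝ := v 0 • (EuclideanSpace.proj 1 : Plane →L[ℝ] ℝ) -
    v 1 • (EuclideanSpace.proj 0 : Plane →L[ℝ] ℝ)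
  have hLc : ∀ w, Lc w = cross v w := fun w => by simp [Lc, cross]
  have hF : ∀ p : ℝ × ℝ, HasFDerivAt
      (fun p : ℝ × ℝ => p.1 * (f (radial c a b p) * cross v (b - a))) _ p := fun p =>
    (hasFDerivAt_fst (p := p)).mul (((hfd _).comp p (hrad p)).mul_const (cross v (b - a)))
  have hG : ∀ p : ℝ × ℝ, HasFDerivAt
      (fun p : ℝ × ℝ => -(f (radial c a b p) * Lc (AffineMap.lineMap a b p.2 - c))) _ p := fun p =>
    (((hfd _).comp p (hrad p)).mul (Lc.hasFDerivAt.comp p (hline p))).neg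
  have key := integral_divergence_prod_Icc_of_hasFDerivAt_of_le _ _ _ _ (0 : ℝ × ℝ) 1
    (by constructor <;> simp)
    (fun p _ => (hF p).continuousAt.continuousWithinAt)
    (fun p _ => (hG p).continuousAt.continuousWithinAt) (fun p _ => hF p) (fun p _ => hG p)
  have hpt : ∀ p : ℝ × ℝ, p.1 * cross (a - c) (b - a) * fderiv ℝ f (radial c a b p) v =
      p.1 * (cross v (b - a) * fderiv ℝ f (radial c a b p) (AffineMap.lineMap a b p.2 - c) -
        cross v (AffineMap.lineMap a b p.2 - c) * fderiv ℝ f (radial c a b p) (b - a)) := by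
    intro p
    rw [← smul_eq_mul (cross v _), ← smul_eq_mul (cross v (AffineMap.lineMap a b p.2 - c)),
      ← map_smul, ← map_smul, ← map_sub, cross_identity, map_smul, smul_eq_mul, ← mul_assoc]
    congr 2
    simp [cross, AffineMap.lineMap_apply_module]
    ring
  have hcont : Continuous fun p : ℝ × ℝ =>
      p.1 * cross (a - c) (b - a) * fderiv ℝ f (radial c a b p) v :=
    (continuous_fst.mul continuous_const).mul
      (((hf.continuous_fderiv (by simp)).comp (continuous_radial c a b)).clm_apply
        continuous_const)
  refine (integral_congr_ae (ae_of_all _ fun p => ?_)).trans ((key ?_).trans ?_)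
  · refine (hpt p).trans ?_
    simp [hLc]
    ring
  · refine (hcont.continuousOn.integrableOn_compact isCompact_Icc).congr_fun (fun p _ => ?_)
      measurableSet_Icc
    refine (hpt p).trans ?_
    simp [hLc]
    ring
  · simp [radial, hLc, ← intervalIntegral.integral_const_mul, mul_comm]
    ring

/-! ### Sets that are star-shaped with respect to a ball -/

/-- Replace `y` by a nearby `z ∈ E`; the error is absorbed by moving the centre to `c + s/(1-s) (y -
z)`, which stays in the ball as soon as `dist y z < (1 - s) ρ`. This is where a whole ball of
centres is needed. -/
lemma lineMap_mem_of_mem_closure {E : Set Plane} {c : Plane} {ρ : ℝ} (hρ : 0 < ρ)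
    (hstar : ∀ y ∈ Metric.ball c ρ, StarConvex ℝ y E)
    {y : Plane} (hy : y ∈ closure E) {s : ℝ} (hs : s ∈ Ico (0 : ℝ) 1) :
    c + s • (y - c) ∈ E := by
  have h1 : 0 < 1 - s := by linarith [hs.2]
  obtain ⟨z, hz, hyz⟩ := Metric.mem_closure_iff.1 hy ((1 - s) * ρ) (by positivity)
  have hc' : c + (s / (1 - s)) • (y - z) ∈ Metric.ball c ρ := by
    rw [Metric.mem_ball, dist_self_add_left, norm_smul, Real.norm_of_nonneg (div_nonneg hs.1 h1.le),
      ← dist_eq_norm]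
    calc s / (1 - s) * dist y z ≤ 1 / (1 - s) * dist y z := by
          gcongr; exact hs.2.le
      _ < 1 / (1 - s) * ((1 - s) * ρ) := by gcongr
      _ = ρ := by field_simp
  have := hstar _ hc' hz h1.le hs.1 (by ring)
  convert this using 1
  rw [smul_add, smul_smul, mul_div_cancel₀ _ h1.ne']
  module

/-- A ray from `c` meets the frontier at most once: of two such points the nearer one would lie in
`E` by `lineMap_mem_of_mem_closure`, but an open set misses its frontier. -/
lemma radial_unique {E : Set Plane} {c : Plane} {ρ : ℝ} (hρ : 0 < ρ) (hE : IsOpen E)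
    (hstar : ∀ y ∈ Metric.ball c ρ, StarConvex ℝ y E)
    {y y' : Plane} (hy : y ∈ frontier E) (hy' : y' ∈ frontier E) {s s' : ℝ} (hs : 0 < s)
    (hs' : 0 < s') (h : c + s • (y - c) = c + s' • (y' - c)) : s = s' ∧ y = y' := by
  have hlt : ∀ {y y' : Plane} (_ : y ∈ frontier E) (_ : y' ∈ frontier E) {s s' : ℝ} (_ : 0 < s)
      (_ : 0 < s') (_ : c + s • (y - c) = c + s' • (y' - c)), ¬ s < s' := by
    intro y y' hy hy' s s' hs hs' h hss
    have : y' = c + (s / s') • (y - c) := by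
      have h2 : s • (y - c) = s' • (y' - c) := add_left_cancel h
      rw [div_eq_inv_mul, mul_smul, h2, smul_smul, inv_mul_cancel₀ hs'.ne']
      module
    have hmem := lineMap_mem_of_mem_closure hρ hstar (frontier_subset_closure hy)
      (s := s / s') ⟨by positivity, (div_lt_one hs').2 hss⟩
    rw [← this] at hmem
    exact (hE.frontier_eq ▸ hy').2 hmem
  have hs2 : s = s' := le_antisymm (not_lt.1 (hlt hy' hy hs' hs h.symm))
    (not_lt.1 (hlt hy hy' hs hs' h))
  subst hs2
  refine ⟨rfl, ?_⟩
  have := smul_right_injective Plane hs.ne' (add_left_cancel h)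
  simpa using this

/-- The half-line from `z` away from `c` is connected and unbounded, so it cannot stay in the
bounded set `E` and must cross the frontier. -/
lemma exists_radial {E : Set Plane} (hE : IsOpen E) (hb : Bornology.IsBounded E) {c z : Plane}
    (hz : z ∈ E) (hzc : z ≠ c) :
    ∃ s ∈ Ioo (0 : ℝ) 1, ∃ y ∈ frontier E, z = c + s • (y - c) := by
  have hcont : Continuous fun r : ℝ => c + r • (z - c) := by fun_prop
  have hpre : IsPreconnected ((fun r : ℝ => c + r • (z - c)) '' Ici 1) :=
    isPreconnected_Ici.image _ hcont.continuousOn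
  have hmeet : (((fun r : ℝ => c + r • (z - c)) '' Ici 1) ∩ frontier E).Nonempty := by
    by_contra hne
    rw [not_nonempty_iff_eq_empty, ← disjoint_iff_inter_eq_empty] at hne
    have hsub : ((fun r : ℝ => c + r • (z - c)) '' Ici 1) ⊆ E := by
      refine hpre.subset_left_of_subset_union hE (isClosed_closure.isOpen_compl (s := closure E)) ?_ ?_ ?_
      · exact disjoint_compl_right.mono_left subset_closure
      · intro w hw
        by_cases hwE : w ∈ closure E
        · left
          by_contra hwE'
          exact (disjoint_left.1 hne hw) (hE.frontier_eq ▸ ⟨hwE, hwE'⟩)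
        · exact Or.inr hwE
      · exact ⟨z, ⟨1, self_mem_Ici, by simp⟩, hz⟩
    obtain ⟨R, hR⟩ := (hb.subset hsub).subset_closedBall c
    have hpos : 0 < ‖z - c‖ := norm_pos_iff.2 (sub_ne_zero.2 hzc)
    have hmem := hR ⟨max 1 ((|R| + 1) / ‖z - c‖), mem_Ici.2 (le_max_left _ _), rfl⟩
    rw [Metric.mem_closedBall, dist_self_add_left, norm_smul,
      Real.norm_of_nonneg (le_trans zero_le_one (le_max_left _ _))] at hmem
    have : (|R| + 1) / ‖z - c‖ * ‖z - c‖ ≤ R :=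
      le_trans (by gcongr; exact le_max_right _ _) hmem
    rw [div_mul_cancel₀ _ hpos.ne'] at this
    linarith [le_abs_self R]
  obtain ⟨y, ⟨r, hr, rfl⟩, hy⟩ := hmeet
  have hr1 : (1 : ℝ) ≤ r := hr
  have hr' : 1 < r := by
    rcases hr1.lt_or_eq with h | h
    · exact h
    · subst h
      simp only [one_smul, add_sub_cancel] at hy
      exact absurd hz (hE.frontier_eq ▸ hy).2
  refine ⟨r⁻¹, ⟨by positivity, inv_lt_one_of_one_lt₀ hr'⟩, _, hy, ?_⟩
  simp [smul_smul, inv_mul_cancel₀ (show r ≠ 0 by positivity)]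

/-! ### Edges of a polygon and their orientation -/

lemma edge_subset_frontier {N : ℕ} {x : Fin N → Plane} {E : Set Plane} (hE : IsPolygon x E)
    (i : Fin N) : edge x i ⊆ frontier E := by
  rw [hE.frontier_eq]
  exact subset_iUnion (edge x) i

lemma lineMap_mem_edge {N : ℕ} (x : Fin N → Plane) (i : Fin N) {t : ℝ} (ht : t ∈ Icc (0 : ℝ) 1) :
    AffineMap.lineMap (x i) (nextVertex x i) t ∈ edge x i := by
  rw [edge, segment_eq_image_lineMap]
  exact mem_image_of_mem _ ht

lemma exists_lineMap_of_mem_frontier {N : ℕ} {x : Fin N → Plane} {E : Set Plane}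
    (hE : IsPolygon x E) {y : Plane} (hy : y ∈ frontier E) :
    ∃ i, ∃ t ∈ Ico (0 : ℝ) 1, y = AffineMap.lineMap (x i) (nextVertex x i) t := by
  rw [hE.frontier_eq] at hy
  obtain ⟨i, hi⟩ := mem_iUnion.1 hy
  rw [edge, segment_eq_image_lineMap] at hi
  obtain ⟨t, ht, rfl⟩ := hi
  rcases ht.2.lt_or_eq with h | h
  · exact ⟨i, t, ⟨ht.1, h⟩, rfl⟩
  -- The final endpoint of an edge is counted as the initial endpoint of the next one.
  · refine ⟨finRotate N i, 0, by simp, ?_⟩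
    simp [h, nextVertex]

lemma IsPolygon.eq_of_lineMap_eq {N : ℕ} {x : Fin N → Plane} {E : Set Plane}
    (hE : IsPolygon x E) {i j : Fin N} {t s : ℝ} (ht : t ∈ Ico (0 : ℝ) 1) (hs : s ∈ Ico (0 : ℝ) 1)
    (h : (AffineMap.lineMap (x i) (nextVertex x i) t : Plane) =
      AffineMap.lineMap (x j) (nextVertex x j) s) : i = j ∧ t = s := by
  have h1 : ((i, t) : Fin N × ℝ) ∈ (univ : Set (Fin N)) ×ˢ Ico (0 : ℝ) 1 := ⟨mem_univ _, ht⟩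
  have h2 : ((j, s) : Fin N × ℝ) ∈ (univ : Set (Fin N)) ×ˢ Ico (0 : ℝ) 1 := ⟨mem_univ _, hs⟩
  exact Prod.mk.inj (hE.simple h1 h2 h)

/-- Converts the outward flux through an edge into the cross product appearing in
`integral_triangle`; for a degenerate edge both sides are zero. -/
lemma dist_mul_inner_normal {N : ℕ} (x : Fin N → Plane) (i : Fin N) (v : Plane) :
    dist (x i) (nextVertex x i) * ⟪normal x i, v⟫ = cross v (nextVertex x i - x i) := by
  by_cases h : dist (x i) (nextVertex x i) = 0
  · rw [h, zero_mul, ← dist_eq_zero.1 h]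
    simp [cross]
  · rw [normal, real_inner_smul_left, ← mul_assoc, mul_inv_cancel₀ h, one_mul,
      EuclideanSpace.inner_eq_star_dotProduct]
    simp [cross, dotProduct, Fin.sum_univ_two]
    ring

/-- The vertices of a polygon run counterclockwise around the centre of a star-shaped polygon. -/
lemma cross_nonneg {N : ℕ} {x : Fin N → Plane} {E : Set Plane} (hE : IsPolygon x E) {c : Plane}
    (hstar : StarConvex ℝ c E) (i : Fin N) : 0 ≤ cross (x i - c) (nextVertex x i - x i) := by
  -- If the cross product is negative, `c` lies strictly on the outer side of the line through the
  -- edge. The segment from `c` to the point `m - ε n` of `E` then crosses the edge near its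
  -- midpoint, and star-shapedness puts the crossing in `E`, although edges lie on the frontier.
  by_contra! hD
  set a := x i with ha
  set b := nextVertex x i with hb
  set D := cross (a - c) (b - a) with hDdef
  set n := normal x i with hn
  set m : Plane := AffineMap.lineMap a b (1 / 2 : ℝ) with hm
  have hab : a ≠ b := by
    rintro h
    rw [hDdef, ← h] at hD
    simp [cross] at hD
  have hd : 0 < dist a b := dist_pos.2 hab
  have hdn : b 0 - a 0 = -(dist a b * n 1) ∧ b 1 - a 1 = dist a b * n 0 := by
    constructor
    · simp [hn, normal, ← ha, ← hb]; field_simp; ring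
    · simp [hn, normal, ← ha, ← hb]; field_simp
  have hnn : n 0 ^ 2 + n 1 ^ 2 = 1 := by
    have h1 : dist a b ^ 2 = (b 0 - a 0) ^ 2 + (b 1 - a 1) ^ 2 := by
      rw [EuclideanSpace.dist_eq, Real.sq_sqrt (by positivity), Fin.sum_univ_two, Real.dist_eq,
        Real.dist_eq, sq_abs, sq_abs]
      ring
    rw [hdn.1, hdn.2] at h1
    have : dist a b ^ 2 * (n 0 ^ 2 + n 1 ^ 2 - 1) = 0 := by linear_combination -h1
    rcases mul_eq_zero.1 this with h | h
    · exact absurd h (by positivity)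
    · linarith
  -- The crossing with the line of the edge: requiring zero normal component relative to `a` forces
  -- the ratio `D / (D - ε |ab|)`.
  let y : ℝ → Plane := fun ε => c + (D / (D - ε * dist a b)) • (m - ε • n - c)
  -- The position of `y ε` along the edge; `(-n₁, n₀)` is the unit tangent.
  let t : ℝ → ℝ := fun ε => (n 0 * (y ε 1 - a 1) - n 1 * (y ε 0 - a 0)) / dist a b
  have hy0 : y 0 = m := by simp [y, div_self hD.ne]
  have ht0 : t 0 = 1 / 2 := by
    have h0 : m 0 - a 0 = 1 / 2 * (b 0 - a 0) := by
      simp [hm, AffineMap.lineMap_apply_module]; ring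
    have h1 : m 1 - a 1 = 1 / 2 * (b 1 - a 1) := by
      simp [hm, AffineMap.lineMap_apply_module]; ring
    simp only [t, hy0]
    rw [h0, h1, hdn.1, hdn.2, div_eq_iff hd.ne']
    linear_combination (1 / 2 * dist a b) * hnn
  have hyc : ContinuousAt y 0 := by
    have : ContinuousAt (fun ε : ℝ => D / (D - ε * dist a b)) 0 :=
      continuousAt_const.div (by fun_prop) (by simpa using hD.ne)
    exact continuousAt_const.add (this.smul (by fun_prop))
  have htc : ContinuousAt t 0 := by
    have hcoord : ∀ j : Fin 2, ContinuousAt (fun ε => y ε j) 0 := fun j =>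
      ((EuclideanSpace.proj j : Plane →L[ℝ] ℝ).continuous.continuousAt).comp hyc
    exact (((hcoord 1).sub continuousAt_const).const_mul _ |>.sub
      (((hcoord 0).sub continuousAt_const).const_mul _)).div_const _
  have htI : ∀ᶠ ε in 𝓝[>] (0 : ℝ), t ε ∈ Ioo (0 : ℝ) 1 :=
    (htc.eventually_mem (by rw [ht0]; exact Ioo_mem_nhds (by norm_num) (by norm_num))).filter_mono
      nhdsWithin_le_nhds
  obtain ⟨ε, ⟨hεE, hεt⟩, hε⟩ :=
    (((hE.counterclockwise i (1 / 2) ⟨by norm_num, by norm_num⟩).and htI).and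
      self_mem_nhdsWithin).exists
  have hε' : 0 < ε := hε
  have hden : D - ε * dist a b < 0 := by nlinarith [mul_pos hε' hd]
  have hyE : y ε ∈ E := by
    have h0 : 0 ≤ D / (D - ε * dist a b) := div_nonneg_of_nonpos hD.le hden.le
    have h1 : D / (D - ε * dist a b) ≤ 1 := by
      rw [div_le_one_of_neg hden]; nlinarith [mul_pos hε' hd]
    have := hstar hεE (a := 1 - D / (D - ε * dist a b)) (b := D / (D - ε * dist a b))
      (by linarith) h0 (by ring)
    convert this using 1
    simp only [y, hm]
    module
  have hyedge : y ε = AffineMap.lineMap a b (t ε) := by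
    have hcr : n 0 * (y ε 0 - a 0) + n 1 * (y ε 1 - a 1) = 0 := by
      have h0 : y ε 0 = c 0 + D / (D - ε * dist a b) * (m 0 - ε * n 0 - c 0) := by simp [y]
      have h1 : y ε 1 = c 1 + D / (D - ε * dist a b) * (m 1 - ε * n 1 - c 1) := by simp [y]
      have hm0 : m 0 = a 0 + 1 / 2 * (b 0 - a 0) := by
        simp [hm, AffineMap.lineMap_apply_module]; ring
      have hm1 : m 1 = a 1 + 1 / 2 * (b 1 - a 1) := by
        simp [hm, AffineMap.lineMap_apply_module]; ring
      have hD2 : D = dist a b * (n 0 * (a 0 - c 0) + n 1 * (a 1 - c 1)) := by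
        simp only [hDdef, cross, PiLp.sub_apply, hdn.1, hdn.2]; ring
      rw [hdn.1] at hm0
      rw [hdn.2] at hm1
      set r := D / (D - ε * dist a b) with hr
      have hr2 : r * (D - ε * dist a b) = D := div_mul_cancel₀ _ hden.ne
      have key : dist a b * (n 0 * (y ε 0 - a 0) + n 1 * (y ε 1 - a 1)) = 0 := by
        rw [h0, h1, hm0, hm1]
        linear_combination hr2 + (1 - r) * hD2 - r * ε * dist a b * hnn
      exact (mul_eq_zero.1 key).resolve_left hd.ne'
    ext j
    have e0 : t ε * (b 0 - a 0) = y ε 0 - a 0 := by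
      rw [hdn.1]; simp only [t]; field_simp
      linear_combination (y ε 0 - a 0) * hnn - n 0 * hcr
    have e1 : t ε * (b 1 - a 1) = y ε 1 - a 1 := by
      rw [hdn.2]; simp only [t]; field_simp
      linear_combination (y ε 1 - a 1) * hnn - n 1 * hcr
    fin_cases j
    · simp [AffineMap.lineMap_apply_module]; linarith
    · simp [AffineMap.lineMap_apply_module]; linarith
  have hfr : y ε ∈ frontier E :=
    edge_subset_frontier hE i (hyedge ▸ lineMap_mem_edge x i (Ioo_subset_Icc_self hεt))
  exact (hE.isOpen.frontier_eq ▸ hfr).2 hyE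

/-! ### Assembling the triangles -/

lemma integral_edgeMeasure {N : ℕ} (x : Fin N → Plane) (i : Fin N) {f : Plane → ℝ}
    (hf : Continuous f) : ∫ y, f y ∂(edgeMeasure x i) = dist (x i) (nextVertex x i) *
      ∫ t in (0 : ℝ)..1, f (AffineMap.lineMap (x i) (nextVertex x i) t) := by
  rw [edgeMeasure, integral_smul_measure, integral_map
    AffineMap.lineMap_continuous.aemeasurable hf.aestronglyMeasurable,
    ENNReal.toReal_ofReal dist_nonneg, intervalIntegral.integral_of_le zero_le_one,
    integral_Icc_eq_integral_Ioc, smul_eq_mul]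

/-- The gradient theorem on a polygon, for functions that are smooth up to the boundary. -/
theorem integral_fderiv_polygon {N : ℕ} {x : Fin N → Plane} {E : Set Plane} {κ : ℝ}
    (hE : IsPolygon x E) (hreg : IsRegular κ x E) {f : Plane → ℝ} (hf : ContDiff ℝ 1 f)
    (v : Plane) : ∫ y in E, fderiv ℝ f y v =
      ∑ i, ⟪normal x i, v⟫ * ∫ y, f y ∂(edgeMeasure x i) := by
  obtain ⟨c, ρ, hρ, -, hball, hstar⟩ := hreg.starShaped
  have hc : StarConvex ℝ c E := hstar c (Metric.mem_ball_self hρ)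
  -- The interval is half-open in the angular variable, so that each ray to a vertex belongs to
  -- exactly one triangle and the pieces are disjoint.
  let S : Set (ℝ × ℝ) := Ioo 0 1 ×ˢ Ico 0 1
  have hS : MeasurableSet S := measurableSet_Ioo.prod measurableSet_Ico
  have hinj : ∀ i j : Fin N, ∀ p ∈ S, ∀ q ∈ S, radial c (x i) (nextVertex x i) p =
      radial c (x j) (nextVertex x j) q → i = j ∧ p = q := by
    intro i j p hp q hq h
    have := radial_unique hρ hE.isOpen hstar
      (edge_subset_frontier hE i (lineMap_mem_edge x i (Ico_subset_Icc_self hp.2)))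
      (edge_subset_frontier hE j (lineMap_mem_edge x j (Ico_subset_Icc_self hq.2)))
      hp.1.1 hq.1.1 h
    have h2 := hE.eq_of_lineMap_eq hp.2 hq.2 this.2
    exact ⟨h2.1, Prod.ext this.1 h2.2⟩
  have hcover : E \ {c} = ⋃ i, radial c (x i) (nextVertex x i) '' S := by
    apply Subset.antisymm
    · rintro z ⟨hz, hzc⟩
      obtain ⟨s, hs, y, hy, rfl⟩ := exists_radial hE.isOpen hE.isBounded hz hzc
      obtain ⟨i, t, ht, rfl⟩ := exists_lineMap_of_mem_frontier hE hy
      exact mem_iUnion.2 ⟨i, (s, t), ⟨hs, ht⟩, rfl⟩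
    · rintro z hz
      obtain ⟨i, p, hp, rfl⟩ := mem_iUnion.1 hz
      have hfr := edge_subset_frontier hE i (lineMap_mem_edge x i (Ico_subset_Icc_self hp.2))
      refine ⟨lineMap_mem_of_mem_closure hρ hstar (frontier_subset_closure hfr)
        ⟨hp.1.1.le, hp.1.2⟩, fun h => ?_⟩
      have h2 : p.1 • (AffineMap.lineMap (x i) (nextVertex x i) p.2 - c) = 0 := by
        simpa [radial] using h
      rcases smul_eq_zero.1 h2 with h3 | h3
      · exact hp.1.1.ne' h3
      · exact (hE.isOpen.frontier_eq ▸ hfr).2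
          (sub_eq_zero.1 h3 ▸ hball (Metric.mem_ball_self hρ))
  have hcont : Continuous fun y => fderiv ℝ f y v :=
    (hf.continuous_fderiv (by simp)).clm_apply continuous_const
  have hintE : IntegrableOn (fun y => fderiv ℝ f y v) E :=
    (hcont.continuousOn.integrableOn_compact hE.isBounded.isCompact_closure).mono_set
      subset_closure
  have hsub : ∀ i, radial c (x i) (nextVertex x i) '' S ⊆ E := fun i =>
    (subset_iUnion (fun i => radial c (x i) (nextVertex x i) '' S) i).trans
      (hcover ▸ sdiff_subset)
  have hae : E =ᵐ[volume] (E \ {c} : Set Plane) :=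
    (sdiff_null_ae_eq_self (measure_singleton c)).symm
  have hSae : S =ᵐ[volume] Icc (0 : ℝ × ℝ) 1 := by
    have : Icc (0 : ℝ × ℝ) 1 = Icc (0 : ℝ) 1 ×ˢ Icc (0 : ℝ) 1 := (Icc_prod_Icc _ _ _ _).symm
    rw [this]
    exact Measure.set_prod_ae_eq Ioo_ae_eq_Icc Ico_ae_eq_Icc
  have htri : ∀ i, ∫ y in radial c (x i) (nextVertex x i) '' S, fderiv ℝ f y v =
      ⟪normal x i, v⟫ * (∫ y, f y ∂(edgeMeasure x i)) +
      ((∫ s in (0 : ℝ)..1, cross v (x i - c) * f (c + s • (x i - c))) -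
        ∫ s in (0 : ℝ)..1, cross v (nextVertex x i - c) * f (c + s • (nextVertex x i - c))) := by
    intro i
    rw [integral_radial_image hS (fun p hp q hq h => (hinj i i p hp q hq h).2),
      integral_edgeMeasure x i hf.continuous, ← mul_assoc, mul_comm ⟪normal x i, v⟫,
      dist_mul_inner_normal, ← integral_triangle hf, ← setIntegral_congr_set hSae]
    refine setIntegral_congr_fun hS fun p hp => ?_
    -- Counterclockwise orientation removes the absolute value from the Jacobian.
    rw [abs_of_nonneg (mul_nonneg hp.1.1.le (cross_nonneg hE hc i))]
  rw [setIntegral_congr_set hae, hcover, integral_iUnion_fintype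
    (fun i => hS.image_of_continuousOn_injOn (continuous_radial _ _ _).continuousOn
      fun p hp q hq h => (hinj i i p hp q hq h).2)
    (fun i j hij => disjoint_left.2 ?_) (fun i => hintE.mono_set (hsub i)),
    Finset.sum_congr rfl fun i _ => htri i, Finset.sum_add_distrib, Finset.sum_sub_distrib]
  -- Consecutive triangles share a ray from `c` and contribute opposite terms on it; a cyclic shift
  -- of the index cancels them.
  · have := Equiv.sum_comp (finRotate N)
      (fun i => ∫ s in (0 : ℝ)..1, cross v (x i - c) * f (c + s • (x i - c)))
    simp only [nextVertex]
    rw [this, sub_self, add_zero]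
  · rintro z ⟨p, hp, rfl⟩ ⟨q, hq, h⟩
    exact hij (hinj j i q hq p hp h).1.symm

/-! ### Green's formula -/

lemma inner_gradient (f : Plane → ℝ) (y e : Plane) : ⟪gradient f y, e⟫ = fderiv ℝ f y e :=
  InnerProductSpace.toDual_symm_apply

lemma tendsto_integral_inner {α F : Type*} [MeasurableSpace α] {μ : Measure α}
    [NormedAddCommGroup F] [InnerProductSpace ℝ F] {f : ℕ → α → F} {g χ : α → F}
    (hf : ∀ n, MemLp (f n) 2 μ) (hg : MemLp g 2 μ) (hχ : MemLp χ 2 μ)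
    (h : Tendsto (fun n => eLpNorm (fun y => f n y - g y) 2 μ) atTop (𝓝 0)) :
    Tendsto (fun n => ∫ y, ⟪f n y, χ y⟫ ∂μ) atTop (𝓝 (∫ y, ⟪g y, χ y⟫ ∂μ)) := by
  have hin : ∀ {u : α → F} (hu : MemLp u 2 μ),
      ⟪hu.toLp u, hχ.toLp χ⟫ = ∫ y, ⟪u y, χ y⟫ ∂μ := by
    intro u hu
    rw [L2.inner_def]
    refine integral_congr_ae ?_
    filter_upwards [hu.coeFn_toLp, hχ.coeFn_toLp] with y h1 h2
    rw [h1, h2]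
  have ht : Tendsto (fun n => (hf n).toLp (f n)) atTop (𝓝 (hg.toLp g)) :=
    (Lp.tendsto_Lp_iff_tendsto_eLpNorm'' f hf g hg).2 h
  have := ht.inner (𝕜 := ℝ) (tendsto_const_nhds (x := hχ.toLp χ))
  simpa only [hin] using this

lemma memLp_of_ae_mem_isCompact {F : Type*} [NormedAddCommGroup F] {μ : Measure Plane}
    [IsFiniteMeasure μ] {K : Set Plane} (hK : IsCompact K) (hμ : ∀ᵐ y ∂μ, y ∈ K) {f : Plane → F}
    (hf : Continuous f) : MemLp f 2 μ := by
  obtain ⟨C, hC⟩ := hK.exists_bound_of_continuousOn hf.continuousOn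
  exact MemLp.of_bound hf.aestronglyMeasurable C (hμ.mono fun y hy => hC y hy)

lemma isFiniteMeasure_restrict {E : Set Plane} (hb : Bornology.IsBounded E) :
    IsFiniteMeasure (volume.restrict E) :=
  ⟨by rw [Measure.restrict_apply_univ]; exact hb.measure_lt_top⟩

lemma memLp_of_continuous {F : Type*} [NormedAddCommGroup F] {E : Set Plane}
    (hb : Bornology.IsBounded E) (hE : IsOpen E) {f : Plane → F} (hf : Continuous f) :
    MemLp f 2 (volume.restrict E) := by
  have := isFiniteMeasure_restrict hb
  exact memLp_of_ae_mem_isCompact hb.isCompact_closure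
    ((ae_restrict_mem hE.measurableSet).mono fun _ h => subset_closure h) hf

instance isFiniteMeasure_edgeMeasure {N : ℕ} (x : Fin N → Plane) (i : Fin N) :
    IsFiniteMeasure (edgeMeasure x i) := by
  have : IsFiniteMeasure ((volume.restrict (Icc (0 : ℝ) 1)).map
      (fun t => (AffineMap.lineMap (x i) (nextVertex x i) t : Plane))) :=
    Measure.isFiniteMeasure_map _ _
  exact Measure.smul_finite _ ENNReal.ofReal_ne_top

lemma edgeMeasure_le {N : ℕ} (x : Fin N → Plane) (i : Fin N) :
    edgeMeasure x i ≤ boundaryMeasure x := by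
  rw [boundaryMeasure, ← Finset.sum_erase_add _ _ (Finset.mem_univ i)]
  exact Measure.le_add_left le_rfl

lemma isCompact_edge {N : ℕ} (x : Fin N → Plane) (i : Fin N) : IsCompact (edge x i) := by
  rw [edge, segment_eq_image_lineMap]
  exact isCompact_Icc.image AffineMap.lineMap_continuous

lemma ae_mem_edge {N : ℕ} (x : Fin N → Plane) (i : Fin N) :
    ∀ᵐ y ∂(edgeMeasure x i), y ∈ edge x i := by
  refine Measure.ae_smul_measure ?_ _
  rw [ae_map_iff (p := (· ∈ edge x i)) AffineMap.lineMap_continuous.aemeasurable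
    (isCompact_edge x i).measurableSet]
  exact ae_restrict_of_forall_mem measurableSet_Icc fun t ht => lineMap_mem_edge x i ht

lemma ae_boundaryMeasure {N : ℕ} {x : Fin N → Plane} {p : Plane → Prop}
    (h : ∀ i, ∀ y ∈ edge x i, p y) : ∀ᵐ y ∂(boundaryMeasure x), p y := by
  rw [boundaryMeasure, ← Measure.sum_fintype, Measure.ae_sum_iff]
  exact fun i => (ae_mem_edge x i).mono (h i)

instance isFiniteMeasure_boundaryMeasure {N : ℕ} (x : Fin N → Plane) :
    IsFiniteMeasure (boundaryMeasure x) := by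
  unfold boundaryMeasure
  infer_instance

lemma memLp_boundaryMeasure {N : ℕ} (x : Fin N → Plane) {f : Plane → ℝ} (hf : Continuous f) :
    MemLp f 2 (boundaryMeasure x) :=
  memLp_of_ae_mem_isCompact (isCompact_iUnion fun i => isCompact_edge x i)
    (ae_boundaryMeasure fun i _ hy => mem_iUnion.2 ⟨i, hy⟩) hf

/-- The gradient theorem for a product of smooth functions. -/
lemma integral_fderiv_mul_polygon {N : ℕ} {x : Fin N → Plane} {E : Set Plane} {κ : ℝ}
    (hE : IsPolygon x E) (hreg : IsRegular κ x E) {f ψ : Plane → ℝ} (hf : ContDiff ℝ 1 f)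
    (hψ : ContDiff ℝ 1 ψ) (e : Plane) :
    (∫ y in E, ⟪gradient f y, ψ y • e⟫) + ∫ y in E, ⟪f y, fderiv ℝ ψ y e⟫ =
      ∑ i, ⟪normal x i, e⟫ * ∫ y, ⟪f y, ψ y⟫ ∂(edgeMeasure x i) := by
  have hmem : ∀ {h : Plane → ℝ}, Continuous h → Integrable h (volume.restrict E) := fun hh =>
    have := isFiniteMeasure_restrict hE.isBounded
    (memLp_of_continuous hE.isBounded hE.isOpen hh).integrable (by norm_num)
  have hcf := (hf.continuous_fderiv (by simp)).clm_apply (continuous_const (y := e))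
  have hcψ := (hψ.continuous_fderiv (by simp)).clm_apply (continuous_const (y := e))
  have h1 : ∀ y, fderiv ℝ (fun y => ψ y * f y) y e =
      ⟪gradient f y, ψ y • e⟫ + ⟪f y, fderiv ℝ ψ y e⟫ := by
    intro y
    rw [fderiv_fun_mul (hψ.differentiable (by simp) y) (hf.differentiable (by simp) y),
      real_inner_smul_right, inner_gradient]
    simp [mul_comm]
  rw [← integral_add, ← integral_congr_ae (ae_of_all _ h1),
    integral_fderiv_polygon hE hreg (hψ.mul hf)]
  · rfl
  · simp only [real_inner_smul_right, inner_gradient]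
    exact hmem (hψ.continuous.mul hcf)
  · exact hmem (hf.continuous.inner hcψ)

/-- Green's formula for a function in `H¹(E)` with a trace. -/
lemma IsTrace.green {N : ℕ} {x : Fin N → Plane} {E : Set Plane} {κ : ℝ}
    (hE : IsPolygon x E) (hreg : IsRegular κ x E) {v : H1 E} {g : Plane → ℝ} (hg : IsTrace x v g)
    {ψ : Plane → ℝ} (hψ : ContDiff ℝ 1 ψ) (e : Plane) :
    (∫ y in E, ⟪grad v y, ψ y • e⟫) + ∫ y in E, ⟪fn v y, fderiv ℝ ψ y e⟫ =
      ∑ i, ⟪normal x i, e⟫ * ∫ y, ⟪g y, ψ y⟫ ∂(edgeMeasure x i) := by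
  obtain ⟨hgm, f, hf, h1, h2, h3⟩ := hg
  have hcψ := (hψ.continuous_fderiv (by simp)).clm_apply (continuous_const (y := e))
  have hE1 : ∀ {F : Type} [NormedAddCommGroup F] {h : Plane → F}, Continuous h →
    MemLp h 2 (volume.restrict E) := fun hh => memLp_of_continuous hE.isBounded hE.isOpen hh
  -- Each term of the formula pairs an `L²`-convergent sequence with a fixed `L²` function, so the
  -- smooth identity passes to the limit.
  have t1 := tendsto_integral_inner (fun n => hE1 (continuous_gradient (hf n)))
    (Lp.memLp (grad v)) (hE1 (hψ.continuous.smul (continuous_const (y := e)))) h2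
  have t2 := tendsto_integral_inner (fun n => hE1 (hf n).continuous)
    (Lp.memLp (fn v)) (hE1 hcψ) h1
  have t3 : ∀ i, Tendsto (fun n => ∫ y, ⟪f n y, ψ y⟫ ∂(edgeMeasure x i)) atTop
      (𝓝 (∫ y, ⟪g y, ψ y⟫ ∂(edgeMeasure x i))) := fun i =>
    tendsto_integral_inner
      (fun n => (memLp_boundaryMeasure x (hf n).continuous).mono_measure (edgeMeasure_le x i))
      (hgm.mono_measure (edgeMeasure_le x i))
      ((memLp_boundaryMeasure x hψ.continuous).mono_measure (edgeMeasure_le x i))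
      (tendsto_of_tendsto_of_tendsto_of_le_of_le tendsto_const_nhds h3 (fun _ => zero_le)
        fun n => eLpNorm_mono_measure _ (edgeMeasure_le x i))
  refine tendsto_nhds_unique (t1.add t2) ?_
  refine (tendsto_finsetSum Finset.univ fun i _ => (t3 i).const_mul ⟪normal x i, e⟫).congr
    fun n => ?_
  exact (integral_fderiv_mul_polygon hE hreg ((hf n).of_le (by simp)) hψ e).symm

/-! ### Smooth functions in `H¹(E)` -/

/-- Apply the gradient theorem to `ψ φ`: the boundary terms vanish, since the support of `φ` lies in
the open set `E`, which is disjoint from its edges. -/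
lemma isWeakGradient_of_contDiff {N : ℕ} {x : Fin N → Plane} {E : Set Plane} {κ : ℝ}
    (hE : IsPolygon x E) (hreg : IsRegular κ x E) {ψ : Plane → ℝ} (hψ : ContDiff ℝ ∞ ψ) :
    IsWeakGradient E ψ (gradient ψ) := by
  intro φ hφ hc hs
  have := isFiniteMeasure_restrict hE.isBounded
  have hmem : ∀ {h : Plane → Plane}, Continuous h → Integrable h (volume.restrict E) := fun hh =>
    (memLp_of_continuous hE.isBounded hE.isOpen hh).integrable (by norm_num)
  have hadd := integral_add (hmem (hψ.continuous.smul (continuous_gradient hφ)))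
    (hmem (hφ.continuous.smul (continuous_gradient hψ)))
  simp only [Pi.smul_apply'] at hadd
  rw [eq_neg_iff_add_eq_zero, ← hadd]
  refine ext_inner_left ℝ fun e => ?_
  have hinn := integral_inner (hmem ((hψ.continuous.smul (continuous_gradient hφ)).add
    (hφ.continuous.smul (continuous_gradient hψ)))) (𝕜 := ℝ) e
  simp only [Pi.add_apply, Pi.smul_apply'] at hinn
  rw [← hinn, inner_zero_right]
  have hpt : ∀ y, ⟪e, ψ y • gradient φ y + φ y • gradient ψ y⟫ =
      fderiv ℝ (fun y => ψ y * φ y) y e := by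
    intro y
    rw [fderiv_fun_mul (hψ.differentiable (by simp) y) (hφ.differentiable (by simp) y),
      inner_add_right, real_inner_smul_right, real_inner_smul_right, real_inner_comm,
      real_inner_comm (gradient ψ y), inner_gradient, inner_gradient]
    simp
  rw [integral_congr_ae (ae_of_all _ hpt),
    integral_fderiv_polygon hE hreg ((hψ.mul hφ).of_le (by simp))]
  refine Finset.sum_eq_zero fun i _ => mul_eq_zero_of_right _ ?_
  refine integral_eq_zero_of_ae ((ae_mem_edge x i).mono fun y hy => ?_)
  have hyE : y ∉ E := (hE.isOpen.frontier_eq ▸ edge_subset_frontier hE i hy).2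
  simp [image_eq_zero_of_notMem_tsupport fun h => hyE (hs h)]

/-- The weak gradient is unique. -/
lemma IsWeakGradient.unique {E : Set Plane} (hE : IsOpen E) (hb : Bornology.IsBounded E)
    {v : Plane → ℝ} {G G' : Plane → Plane} (hG : MemLp G 2 (volume.restrict E))
    (hG' : MemLp G' 2 (volume.restrict E)) (h : IsWeakGradient E v G)
    (h' : IsWeakGradient E v G') : G =ᵐ[volume.restrict E] G' := by
  have := isFiniteMeasure_restrict hb
  have hint : Integrable (fun y => G y - G' y) (volume.restrict E) :=
    (hG.sub hG').integrable (by norm_num)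
  have hz := hE.ae_eq_zero_of_integral_contDiff_smul_eq_zero
    (hint.locallyIntegrable.locallyIntegrableOn E) fun φ hφ hc hs => by
      simp only [smul_sub]
      rw [integral_sub (integrable_smul_of_test (memLp_test hφ hc E) hG)
        (integrable_smul_of_test (memLp_test hφ hc E) hG'), sub_eq_zero, ← neg_inj,
        ← h φ hφ hc hs, ← h' φ hφ hc hs]
  filter_upwards [hz, ae_restrict_mem hE.measurableSet] with y hy hyE
  exact sub_eq_zero.1 (hy hyE)

lemma IsWeakGradient.congr {E : Set Plane} {v v' : Plane → ℝ} {G G' : Plane → Plane}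
    (h : IsWeakGradient E v G) (hv : v =ᵐ[volume.restrict E] v')
    (hG : G =ᵐ[volume.restrict E] G') : IsWeakGradient E v' G' := by
  intro φ hφ hc hs
  rw [← integral_congr_ae (hv.mono fun y hy => congrArg (· • gradient φ y) hy),
    ← integral_congr_ae (hG.mono fun y hy => congrArg (φ y • ·) hy)]
  exact h φ hφ hc hs

/-- The element of `H¹(E)` given by a smooth function. -/
def ofSmooth {N : ℕ} {x : Fin N → Plane} {E : Set Plane} {κ : ℝ} (hE : IsPolygon x E)
    (hreg : IsRegular κ x E) {ψ : Plane → ℝ} (hψ : ContDiff ℝ ∞ ψ) : H1 E :=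
  ⟨((memLp_of_continuous hE.isBounded hE.isOpen hψ.continuous).toLp ψ,
    (memLp_of_continuous hE.isBounded hE.isOpen (continuous_gradient hψ)).toLp (gradient ψ)),
    (isWeakGradient_of_contDiff hE hreg hψ).congr
      (memLp_of_continuous hE.isBounded hE.isOpen hψ.continuous).coeFn_toLp.symm
      (memLp_of_continuous hE.isBounded hE.isOpen (continuous_gradient hψ)).coeFn_toLp.symm⟩

section
variable {N : ℕ} {x : Fin N → Plane} {E : Set Plane} {κ : ℝ} (hE : IsPolygon x E)
  (hreg : IsRegular κ x E) {ψ : Plane → ℝ} (hψ : ContDiff ℝ ∞ ψ)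

lemma fn_ofSmooth : (fn (ofSmooth hE hreg hψ) : Plane → ℝ) =ᵐ[volume.restrict E] ψ :=
  (memLp_of_continuous hE.isBounded hE.isOpen hψ.continuous).coeFn_toLp

lemma grad_ofSmooth :
    (grad (ofSmooth hE hreg hψ) : Plane → Plane) =ᵐ[volume.restrict E] gradient ψ :=
  (memLp_of_continuous hE.isBounded hE.isOpen (continuous_gradient hψ)).coeFn_toLp

lemma isTrace_ofSmooth : IsTrace x (ofSmooth hE hreg hψ) ψ := by
  refine ⟨memLp_boundaryMeasure x hψ.continuous, fun _ => ψ, fun _ => hψ, ?_, ?_, ?_⟩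
  · refine tendsto_const_nhds.congr fun _ => ?_
    rw [eLpNorm_congr_ae (g := 0) ((fn_ofSmooth hE hreg hψ).mono fun y hy => by simp [hy]),
      eLpNorm_zero]
  · refine tendsto_const_nhds.congr fun _ => ?_
    rw [eLpNorm_congr_ae (g := 0) ((grad_ofSmooth hE hreg hψ).mono fun y hy => by simp [hy]),
      eLpNorm_zero]
  · simp

end

/-- `IsPoly` constrains only the function component of an element of `H¹(E)`; this recovers its
gradient component by uniqueness. -/
lemma grad_eq_gradient_of_fn_eq {N : ℕ} {x : Fin N → Plane} {E : Set Plane} {κ : ℝ}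
    (hE : IsPolygon x E) (hreg : IsRegular κ x E) {ψ : Plane → ℝ} (v : H1 E)
    (hψ : ContDiff ℝ ∞ ψ) (hv : (fn v : Plane → ℝ) =ᵐ[volume.restrict E] ψ) :
    (grad v : Plane → Plane) =ᵐ[volume.restrict E] gradient ψ :=
  IsWeakGradient.unique hE.isOpen hE.isBounded (Lp.memLp _)
    (memLp_of_continuous hE.isBounded hE.isOpen (continuous_gradient hψ))
    (IsWeakGradient.congr v.2 hv .rfl) (isWeakGradient_of_contDiff hE hreg hψ)

/-! ### Dilations and mollification -/

lemma map_dilation {t : ℝ} (ht : 0 < t) (c z : Plane) :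
    Measure.map (fun y : Plane => c + t⁻¹ • (y - z - c)) volume =
      ENNReal.ofReal (t ^ 2) • volume := by
  have hfun : (fun y : Plane => c + t⁻¹ • (y - z - c)) =
      (fun y => (c - t⁻¹ • (z + c)) + y) ∘ (fun y : Plane => t⁻¹ • y) := by
    ext1 y; simp only [Function.comp]; module
  rw [hfun, ← Measure.map_map (measurable_const_add _) (measurable_const_smul _),
    Measure.map_addHaar_smul _ (inv_ne_zero ht.ne'), Measure.map_smul, map_add_left_eq_self]
  simp [abs_of_pos ht]

lemma continuous_dilation (t : ℝ) (c z : Plane) :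
    Continuous (fun y : Plane => c + t⁻¹ • (y - z - c)) := by fun_prop

/-- The pushforward has density `t² ≤ 1`. Hence shrinking does not increase the `L²` norm, which
gives bounds uniform in `t` and in the translation. -/
lemma map_dilation_le {t : ℝ} (ht : t ∈ Ioo (0 : ℝ) 1) (c z : Plane) :
    Measure.map (fun y : Plane => c + t⁻¹ • (y - z - c)) volume ≤ volume := by
  rw [map_dilation ht.1]
  refine Measure.le_intro fun s _ _ => ?_
  rw [Measure.smul_apply, smul_eq_mul]
  refine mul_le_of_le_one_left (zero_le) ?_
  rw [ENNReal.ofReal_le_one]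
  nlinarith [ht.1, ht.2]

section
variable {F : Type*} [NormedAddCommGroup F]

lemma memLp_comp_dilation {f : Plane → F} (hf : MemLp f 2 volume) {t : ℝ}
    (ht : t ∈ Ioo (0 : ℝ) 1) (c z : Plane) :
    MemLp (fun y => f (c + t⁻¹ • (y - z - c))) 2 volume :=
  (hf.mono_measure (map_dilation_le ht c z)).comp_of_map (continuous_dilation t c z).aemeasurable

lemma eLpNorm_comp_dilation_le {f : Plane → F} (hf : AEStronglyMeasurable f volume) {t : ℝ}
    (ht : t ∈ Ioo (0 : ℝ) 1) (c z : Plane) :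
    eLpNorm (fun y => f (c + t⁻¹ • (y - z - c))) 2 volume ≤ eLpNorm f 2 volume := by
  have h := eLpNorm_map_measure (p := 2) (hf.mono_measure (map_dilation_le ht c z))
    (continuous_dilation t c z).aemeasurable
  rw [← Function.comp_def f, ← h]
  exact eLpNorm_mono_measure _ (map_dilation_le ht c z)

variable [InnerProductSpace ℝ F]

lemma integrable_inner_of_memLp {α : Type*} [MeasurableSpace α] {μ : Measure α} {f g : α → F}
    (hf : MemLp f 2 μ) (hg : MemLp g 2 μ) : Integrable (fun y => ⟪f y, g y⟫) μ := by
  refine (L2.integrable_inner (𝕜 := ℝ) (hf.toLp f) (hg.toLp g)).congr ?_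
  filter_upwards [hf.coeFn_toLp, hg.coeFn_toLp] with y h1 h2
  rw [h1, h2]

lemma abs_integral_inner_le {α : Type*} [MeasurableSpace α] {μ : Measure α} {f g : α → F}
    (hf : MemLp f 2 μ) (hg : MemLp g 2 μ) :
    |∫ y, ⟪f y, g y⟫ ∂μ| ≤ (eLpNorm f 2 μ).toReal * (eLpNorm g 2 μ).toReal := by
  have h : ∫ y, ⟪f y, g y⟫ ∂μ = ⟪hf.toLp f, hg.toLp g⟫ := by
    rw [L2.inner_def]
    refine integral_congr_ae ?_
    filter_upwards [hf.coeFn_toLp, hg.coeFn_toLp] with y h1 h2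
    rw [h1, h2]
  rw [h, ← Lp.norm_toLp f hf, ← Lp.norm_toLp g hg]
  exact abs_real_inner_le_norm _ _

/-- Dilations and translations are weakly continuous in `L²`. -/
lemma tendsto_integral_dilation {f g : Plane → F} (hf : MemLp f 2 volume)
    (hg : MemLp g 2 volume) (c : Plane) :
    Tendsto (fun p : ℝ × Plane => ∫ y, ⟪g y, f (c + p.1⁻¹ • (y - p.2 - c))⟫)
      (𝓝[Ioo 0 1 ×ˢ univ] (1, 0)) (𝓝 (∫ y, ⟪g y, f y⟫)) := by
  rw [Metric.tendsto_nhds]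
  intro ε hε
  set M := (eLpNorm g 2 volume).toReal with hM
  have hM0 : 0 ≤ M := ENNReal.toReal_nonneg
  -- Approximate `f` by a continuous `f'` of compact support. Each of the two replacement errors
  -- costs at most `ε / 4`; the `+ 1` guards against `M = 0`.
  obtain ⟨f', hf'c, hff', hf'cont, hf'm⟩ := hf.exists_hasCompactSupport_eLpNorm_sub_le
    (by norm_num) (ε := ENNReal.ofReal (ε / (4 * (M + 1)))) (by simp; positivity)
  have hsub : MemLp (fun y => f y - f' y) 2 volume := hf.sub hf'm
  have hle : (eLpNorm (fun y => f y - f' y) 2 volume).toReal ≤ ε / (4 * (M + 1)) :=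
    ENNReal.toReal_le_of_le_ofReal (by positivity) hff'
  have hMε : M * (ε / (4 * (M + 1))) ≤ ε / 4 := by
    rw [mul_div_assoc', div_le_div_iff₀ (by positivity) (by positivity)]
    nlinarith
  have hlim : Tendsto (fun p : ℝ × Plane => ∫ y, ⟪g y, f' (c + p.1⁻¹ • (y - p.2 - c))⟫)
      (𝓝 (1, 0)) (𝓝 (∫ y, ⟪g y, f' y⟫)) := by
    obtain ⟨C, hC⟩ := hf'c.exists_bound_of_continuous hf'cont
    obtain ⟨R, hR⟩ := hf'c.isCompact.isBounded.subset_closedBall (0 : Plane)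
    -- For `t < 2` and `‖z‖ < 1` all the moved copies of `f'` are supported in the ball of radius
    -- `R'`, so `C ‖g‖` on that ball dominates.
    set R' : ℝ := 2 * (|R| + ‖c‖) + ‖c‖ + 1 with hR'
    have hgB : IntegrableOn g (Metric.closedBall 0 R') volume := by
      have : IsFiniteMeasure (volume.restrict (Metric.closedBall (0 : Plane) R')) :=
        isFiniteMeasure_restrict Metric.isBounded_closedBall
      exact (hg.restrict _).integrable (by norm_num)
    have hbound : Integrable ((Metric.closedBall 0 R').indicator fun y => ‖g y‖ * C) volume :=
      (integrable_indicator_iff Metric.isClosed_closedBall.measurableSet).2 (hgB.norm.mul_const C)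
    have hnear : ∀ᶠ p : ℝ × Plane in 𝓝 (1, 0), p.1 ∈ Ioo (0 : ℝ) 2 ∧ ‖p.2‖ < 1 := by
      refine (continuous_fst.continuousAt.eventually_mem
        (Ioo_mem_nhds (by norm_num) (by norm_num))).and ?_
      exact (continuous_snd.norm.continuousAt (x := ((1 : ℝ), (0 : Plane)))).eventually_lt
        continuousAt_const (by simp)
    refine tendsto_integral_filter_of_dominated_convergence _ ?_ ?_ hbound ?_
    · exact Eventually.of_forall fun p => hg.1.inner
        (hf'cont.comp (continuous_dilation p.1 c p.2)).aestronglyMeasurable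
    · filter_upwards [hnear] with p hp
      refine Eventually.of_forall fun y => ?_
      by_cases hy : y ∈ Metric.closedBall (0 : Plane) R'
      · rw [indicator_of_mem hy]
        exact (norm_inner_le_norm _ _).trans (by gcongr; exact hC _)
      · rw [indicator_of_notMem hy]
        have hz : f' (c + p.1⁻¹ • (y - p.2 - c)) = 0 := by
          by_contra hne
          apply hy
          have h1 := hR (subset_tsupport _ hne)
          rw [mem_closedBall_zero_iff] at h1 ⊢
          set w := c + p.1⁻¹ • (y - p.2 - c) with hw
          have hyw : y = p.1 • (w - c) + p.2 + c := by
            rw [hw, add_sub_cancel_left, smul_smul, mul_inv_cancel₀ hp.1.1.ne']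
            module
          rw [hyw]
          calc ‖p.1 • (w - c) + p.2 + c‖ ≤ ‖p.1 • (w - c)‖ + ‖p.2‖ + ‖c‖ := norm_add₃_le
            _ ≤ 2 * (|R| + ‖c‖) + 1 + ‖c‖ := by
                gcongr
                · rw [norm_smul, Real.norm_of_nonneg hp.1.1.le]
                  gcongr
                  · exact hp.1.2.le
                  · exact (norm_sub_le _ _).trans (by gcongr; exact h1.trans (le_abs_self R))
                · exact hp.2.le
            _ = R' := by rw [hR']; ring
        rw [hz, inner_zero_right, norm_zero]
    · refine Eventually.of_forall fun y => ?_
      have hct : ContinuousAt (fun p : ℝ × Plane => ⟪g y, f' (c + p.1⁻¹ • (y - p.2 - c))⟫)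
          (1, 0) := by
        refine continuousAt_const.inner (hf'cont.continuousAt.comp ?_)
        have : ContinuousAt (fun p : ℝ × Plane => p.1⁻¹) (1, 0) :=
          continuousAt_fst.inv₀ (by simp)
        exact continuousAt_const.add (this.smul (by fun_prop))
      simpa [ContinuousAt] using hct
  filter_upwards [self_mem_nhdsWithin,
    Metric.tendsto_nhds.1 (hlim.mono_left nhdsWithin_le_nhds) _ (half_pos hε)]
    with p hp hpl
  have e1 : |∫ y, ⟪g y, f (c + p.1⁻¹ • (y - p.2 - c)) - f' (c + p.1⁻¹ • (y - p.2 - c))⟫| ≤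
      ε / 4 := by
    refine (abs_integral_inner_le hg (memLp_comp_dilation hsub hp.1 c p.2)).trans
      (le_trans ?_ hMε)
    rw [← hM]
    gcongr
    exact (ENNReal.toReal_mono hsub.2.ne (eLpNorm_comp_dilation_le hsub.1 hp.1 c p.2)).trans hle
  have e2 : |∫ y, ⟪g y, f y - f' y⟫| ≤ ε / 4 :=
    (abs_integral_inner_le hg hsub).trans (le_trans (by rw [← hM]; gcongr) hMε)
  simp only [inner_sub_right] at e1 e2
  rw [integral_sub (integrable_inner_of_memLp hg (memLp_comp_dilation hf hp.1 c p.2))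
    (integrable_inner_of_memLp hg (memLp_comp_dilation hf'm hp.1 c p.2))] at e1
  rw [integral_sub (integrable_inner_of_memLp hg hf) (integrable_inner_of_memLp hg hf'm)] at e2
  rw [Real.dist_eq] at hpl
  rw [Real.dist_eq, abs_lt]
  rw [abs_le] at e1 e2
  rw [abs_lt] at hpl
  constructor <;> linarith [e1.1, e1.2, e2.1, e2.2, hpl.1, hpl.2]

/-- Bound `|⟪g, f⟫|` by `‖g‖² + ‖f‖²`: the first term gives a product of integrable functions, the
second a convolution integrand. -/
lemma integrable_mollified {ρ : Plane → ℝ} (hρ : Continuous ρ) (hρc : HasCompactSupport ρ)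
    {f g : Plane → F} (hf : MemLp f 2 volume) (hg : MemLp g 2 volume) :
    Integrable (fun p : Plane × Plane => ρ p.2 * ⟪g p.1, f (p.1 - p.2)⟫)
      (volume.prod volume) := by
  have hρi : Integrable ρ volume := hρ.integrable_of_hasCompactSupport hρc
  have h1 : Integrable (fun p : Plane × Plane => ‖g p.1‖ ^ 2 * ρ p.2) (volume.prod volume) :=
    (hg.integrable_norm_pow (by norm_num)).mul_prod hρi
  have h2 : Integrable (fun p : Plane × Plane => ρ p.2 * ‖f (p.1 - p.2)‖ ^ 2)
      (volume.prod volume) :=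
    hρi.convolution_integrand (ContinuousLinearMap.mul ℝ ℝ)
      (hf.integrable_norm_pow (p := 2) (by norm_num))
  have hm : AEStronglyMeasurable (fun p : Plane × Plane => ρ p.2 * ⟪g p.1, f (p.1 - p.2)⟫)
      (volume.prod volume) :=
    (hρ.comp continuous_snd).aestronglyMeasurable.mul
      (hg.1.comp_fst.inner (hf.1.comp_quasiMeasurePreserving
        (quasiMeasurePreserving_sub volume volume)))
  refine (h1.norm.add h2.norm).mono hm (Eventually.of_forall fun p => ?_)
  rw [norm_mul, Pi.add_apply, norm_mul, norm_mul, norm_pow, norm_pow, norm_norm, norm_norm,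
    mul_comm _ ‖ρ p.2‖, ← mul_add, norm_mul, norm_norm,
    Real.norm_of_nonneg (add_nonneg (sq_nonneg _) (sq_nonneg _))]
  gcongr
  refine (norm_inner_le_norm _ _).trans ?_
  nlinarith [sq_nonneg (‖g p.1‖ - ‖f (p.1 - p.2)‖), sq_nonneg (‖g p.1‖), sq_nonneg ‖f (p.1 - p.2)‖]

lemma integrable_smul_translate {ρ : Plane → ℝ} (hρ : Continuous ρ) (hρc : HasCompactSupport ρ)
    {f : Plane → F} (hf : MemLp f 2 volume) (y : Plane) :
    Integrable (fun z => ρ z • f (y - z)) volume :=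
  hρc.convolutionExists_left (ContinuousLinearMap.lsmul ℝ ℝ) hρ
    (hf.locallyIntegrable (by norm_num)) y

/-- By Fubini, pairing with a mollification is averaging the pairings with translates, so
convergence of mollifications reduces to continuity of translated pairings. -/
lemma integral_inner_mollified [CompleteSpace F] {ρ : Plane → ℝ} (hρ : Continuous ρ)
    (hρc : HasCompactSupport ρ) {f g : Plane → F} (hf : MemLp f 2 volume)
    (hg : MemLp g 2 volume) :
    ∫ y, ⟪g y, ∫ z, ρ z • f (y - z)⟫ = ∫ z, ρ z * ∫ y, ⟪g y, f (y - z)⟫ := by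
  have h1 : ∀ y, ⟪g y, ∫ z, ρ z • f (y - z)⟫ = ∫ z, ρ z * ⟪g y, f (y - z)⟫ := by
    intro y
    rw [← integral_inner (𝕜 := ℝ) (integrable_smul_translate hρ hρc hf y)]
    simp only [real_inner_smul_right]
  simp only [h1, ← integral_const_mul]
  exact integral_integral_swap (integrable_mollified hρ hρc hf hg)

end

/-! ### Functions with zero trace -/

/-- `G` is the weak gradient of `v` on the whole plane, tested with functions that need not vanish
at infinity. -/
def IsGlobalWeakGradient (v : Plane → ℝ) (G : Plane → Plane) : Prop :=
  ∀ ψ : Plane → ℝ, ContDiff ℝ 1 ψ → ∀ e : Plane,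
    (∫ y, ⟪G y, ψ y • e⟫) + ∫ y, ⟪v y, fderiv ℝ ψ y e⟫ = 0

/-- With zero trace the boundary term of Green's formula disappears, so extension by zero creates no
singular part on the boundary. -/
lemma IsTrace.isGlobalWeakGradient {N : ℕ} {x : Fin N → Plane} {E : Set Plane} {κ : ℝ}
    (hE : IsPolygon x E) (hreg : IsRegular κ x E) {v : H1 E} (hv : IsTrace x v 0) :
    IsGlobalWeakGradient (E.indicator (fn v)) (E.indicator (grad v)) := by
  intro ψ hψ e
  have h := hv.green hE hreg hψ e
  simp only [Pi.zero_apply, inner_zero_left, integral_zero, mul_zero, Finset.sum_const_zero] at h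
  rw [← h, ← integral_indicator hE.isOpen.measurableSet,
    ← integral_indicator hE.isOpen.measurableSet]
  congr 2 <;> ext y <;> by_cases hy : y ∈ E <;> simp [hy]

lemma integral_comp_dilation (t : ℝ) (c : Plane) (h : Plane → ℝ) :
    ∫ y, h (c + t⁻¹ • (y - c)) = t ^ 2 * ∫ y, h y := by
  rw [integral_sub_right_eq_self (fun y : Plane => h (c + t⁻¹ • y)) c,
    Measure.integral_comp_inv_smul volume (fun y : Plane => h (c + y)) t,
    integral_add_left_eq_self h c]
  simp

/-- Test with `ψ` composed with the inverse dilation `w ↦ c + t (w - c)`; the chain rule supplies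
the factor that `t⁻¹` compensates. -/
lemma IsGlobalWeakGradient.dilation {v : Plane → ℝ} {G : Plane → Plane}
    (h : IsGlobalWeakGradient v G) {t : ℝ} (ht : 0 < t) (c : Plane) :
    IsGlobalWeakGradient (fun y => v (c + t⁻¹ • (y - c)))
      (fun y => t⁻¹ • G (c + t⁻¹ • (y - c))) := by
  intro ψ hψ e
  have hinv : ∀ y : Plane, c + t • ((c + t⁻¹ • (y - c)) - c) = y := by
    intro y
    rw [add_sub_cancel_left, smul_smul, mul_inv_cancel₀ ht.ne']
    module
  have hB : ContDiff ℝ 1 (fun w : Plane => c + t • (w - c)) := by fun_prop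
  have hBd : ∀ w : Plane, HasFDerivAt (fun w : Plane => c + t • (w - c))
      (t • ContinuousLinearMap.id ℝ Plane) w := fun w =>
    (((hasFDerivAt_id w).sub_const c).const_smul t).const_add c
  have hd : ∀ w, fderiv ℝ (fun w => ψ (c + t • (w - c))) w e =
      t * fderiv ℝ ψ (c + t • (w - c)) e := by
    intro w
    have := ((hψ.differentiable (by simp) _).hasFDerivAt.comp w (hBd w)).fderiv
    rw [Function.comp_def] at this
    rw [this]
    simp
  have key := h _ (hψ.comp hB) e
  simp only [Function.comp_def, hd] at key
  have e1 := integral_comp_dilation t c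
    (fun w => t⁻¹ * ⟪G w, ψ (c + t • (w - c)) • e⟫)
  have e2 := integral_comp_dilation t c
    (fun w => t⁻¹ * ⟪v w, t * fderiv ℝ ψ (c + t • (w - c)) e⟫)
  simp only [hinv] at e1 e2
  have e2' : ∀ y, ⟪v (c + t⁻¹ • (y - c)), fderiv ℝ ψ y e⟫ =
      t⁻¹ * ⟪v (c + t⁻¹ • (y - c)), t * fderiv ℝ ψ y e⟫ := by
    intro y
    rw [← smul_eq_mul t, real_inner_smul_right, ← mul_assoc, inv_mul_cancel₀ ht.ne', one_mul]
  simp only [real_inner_smul_left]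
  rw [integral_congr_ae (ae_of_all _ e2'), e1, e2, integral_const_mul, integral_const_mul,
    ← mul_add, ← mul_add, key, mul_zero, mul_zero]

/-- The mollification of a function with a weak gradient on the whole plane. -/
lemma IsGlobalWeakGradient.gradient_mollified {v : Plane → ℝ} {G : Plane → Plane}
    (h : IsGlobalWeakGradient v G) (hv : MemLp v 2 volume) (hG : MemLp G 2 volume)
    {ρ : Plane → ℝ} (hρ : ContDiff ℝ ∞ ρ) (hρc : HasCompactSupport ρ) :
    ContDiff ℝ ∞ (fun y => ∫ z, ρ z • v (y - z)) ∧
      ∀ y, gradient (fun y => ∫ z, ρ z • v (y - z)) y = ∫ z, ρ z • G (y - z) := by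
  have hvl : LocallyIntegrable v volume := hv.locallyIntegrable (by norm_num)
  refine ⟨hρc.contDiff_convolution_left (ContinuousLinearMap.lsmul ℝ ℝ) hρ hvl, fun y => ?_⟩
  refine ext_inner_right ℝ fun e => ?_
  have hconv := hρc.hasFDerivAt_convolution_left (ContinuousLinearMap.lsmul ℝ ℝ)
    (hρ.of_le (by simp)) hvl y
  have hex : ConvolutionExistsAt (fderiv ℝ ρ) v y
      ((ContinuousLinearMap.lsmul ℝ ℝ).precompL Plane) volume :=
    (hρc.fderiv ℝ).convolutionExists_left _ (hρ.continuous_fderiv (by simp)) hvl y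
  have h1 : ⟪gradient (fun y => ∫ z, ρ z • v (y - z)) y, e⟫ =
      ∫ z, fderiv ℝ ρ z e * v (y - z) := by
    have h2 : HasFDerivAt (fun y => ∫ z, ρ z • v (y - z)) _ y := hconv
    rw [inner_gradient, h2.fderiv, convolution_def, ContinuousLinearMap.integral_apply hex]
    refine integral_congr_ae (ae_of_all _ fun z => ?_)
    simp
  have hψd : ∀ w, fderiv ℝ (fun w => ρ (y - w)) w e = -fderiv ℝ ρ (y - w) e := by
    intro w
    have := ((hρ.differentiable (by simp) (y - w)).hasFDerivAt.comp w
      ((hasFDerivAt_id w).const_sub y)).fderiv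
    rw [Function.comp_def] at this
    rw [this]
    simp
  -- Testing against the reflected kernel `w ↦ ρ (y - w)` moves the derivative from `ρ` onto `v`.
  have key := h (fun w => ρ (y - w)) ((hρ.of_le (by simp)).comp (by fun_prop)) e
  simp only [hψd] at key
  have e1 := integral_sub_left_eq_self (μ := volume)
    (fun w => ⟪G w, ρ (y - w) • e⟫) y
  have e2 := integral_sub_left_eq_self (μ := volume)
    (fun w => ⟪v w, -fderiv ℝ ρ (y - w) e⟫) y
  simp only [sub_sub_cancel] at e1 e2
  have hint := integrable_smul_translate hρ.continuous hρc hG y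
  rw [h1, real_inner_comm, ← integral_inner (𝕜 := ℝ) hint]
  rw [← e1, ← e2] at key
  have c1 : ∫ z, ⟪e, ρ z • G (y - z)⟫ = ∫ z, ⟪G (y - z), ρ z • e⟫ :=
    integral_congr_ae (ae_of_all _ fun z => by
      simp only [real_inner_smul_right]; rw [real_inner_comm])
  have c2 : ∫ z, ⟪v (y - z), -fderiv ℝ ρ z e⟫ = -∫ z, fderiv ℝ ρ z e * v (y - z) := by
    rw [← integral_neg]
    exact integral_congr_ae (ae_of_all _ fun z => by simp)
  rw [c1]
  rw [c2] at key
  linarith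

/-- The support of a mollification. -/
lemma tsupport_mollified_subset {F : Type*} [NormedAddCommGroup F] [NormedSpace ℝ F] {ρ : Plane → ℝ}
    {v : Plane → F} {K : Set Plane} (hK : IsCompact K) {r : ℝ} (hr : 0 ≤ r)
    (hρ : Function.support ρ ⊆ Metric.closedBall 0 r) (hv : Function.support v ⊆ K) :
    tsupport (fun y => ∫ z, ρ z • v (y - z)) ⊆ Metric.cthickening r K := by
  refine closure_minimal (fun y hy => ?_) Metric.isClosed_cthickening
  rw [← hK.add_closedBall_zero hr]
  have : ∃ z, ρ z • v (y - z) ≠ 0 := by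
    by_contra! hz
    exact hy (by simp [hz])
  obtain ⟨z, hz⟩ := this
  rw [smul_ne_zero_iff] at hz
  exact ⟨y - z, hv hz.2, z, hρ hz.1, sub_add_cancel y z⟩

/-- Green's formula for a function with zero trace and its own Laplacian. -/
theorem integral_grad_sq_of_trace_zero {N : ℕ} {x : Fin N → Plane} {E : Set Plane} {κ : ℝ}
    (hE : IsPolygon x E) (hreg : IsRegular κ x E) {v : H1 E} (hv : IsTrace x v 0)
    {q : Plane → ℝ} (hq : Continuous q) (hΔ : HasWeakLaplacian v q) :
    ∫ y in E, ⟪grad v y, grad v y⟫ = -∫ y in E, q y * fn v y := by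
  obtain ⟨c, ρ₀, hρ₀, -, hball, hstar⟩ := hreg.starShaped
  have hmE := hE.isOpen.measurableSet
  set V : Plane → ℝ := E.indicator (fn v) with hV
  set G : Plane → Plane := E.indicator (grad v) with hG
  set Q : Plane → ℝ := E.indicator q with hQ
  have hVm : MemLp V 2 volume := (memLp_indicator_iff_restrict hmE).2 (Lp.memLp (fn v))
  have hGm : MemLp G 2 volume := (memLp_indicator_iff_restrict hmE).2 (Lp.memLp (grad v))
  have hQm : MemLp Q 2 volume := (memLp_indicator_iff_restrict hmE).2
    (memLp_of_continuous hE.isBounded hE.isOpen hq)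
  have hVG : IsGlobalWeakGradient V G := hv.isGlobalWeakGradient hE hreg
  -- `J (t, z)` is the weak Laplace equation tested formally with the copy of `v` shrunk by `t` and
  -- translated by `z`. Its limit `J₀` at `(1, 0)` is the quantity that must vanish.
  let J : ℝ × Plane → ℝ := fun p =>
    p.1⁻¹ * (∫ y, ⟪G y, G (c + p.1⁻¹ • (y - p.2 - c))⟫) +
      ∫ y, ⟪Q y, V (c + p.1⁻¹ • (y - p.2 - c))⟫
  set J₀ : ℝ := (∫ y, ⟪G y, G y⟫) + ∫ y, ⟪Q y, V y⟫ with hJ₀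
  have hJ : Tendsto J (𝓝[Ioo 0 1 ×ˢ univ] (1, 0)) (𝓝 J₀) := by
    have h1 : Tendsto (fun p : ℝ × Plane => p.1⁻¹) (𝓝[Ioo 0 1 ×ˢ univ] (1, 0)) (𝓝 1) := by
      have : ContinuousAt (fun p : ℝ × Plane => p.1⁻¹) (1, 0) :=
        continuousAt_fst.inv₀ (by simp)
      simpa [ContinuousAt] using this.tendsto.mono_left nhdsWithin_le_nhds
    have := (h1.mul (tendsto_integral_dilation hGm hGm c)).add
      (tendsto_integral_dilation hVm hQm c)
    rwa [one_mul] at this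
  have hzero : J₀ = 0 := by
    by_contra hne
    have hpos : 0 < |J₀| / 2 := half_pos (abs_pos.2 hne)
    obtain ⟨η, hη, hηJ⟩ := Metric.mem_nhdsWithin_iff.1 (Metric.tendsto_nhds.1 hJ _ hpos)
    -- Chosen so that `0 < t < 1` and `|t - 1| < η`.
    set t : ℝ := 1 - min η 1 / 2 with ht
    have hmin : 0 < min η 1 := lt_min hη one_pos
    have htI : t ∈ Ioo (0 : ℝ) 1 := by
      constructor <;> [linarith [min_le_right η 1]; linarith]
    set K : Set Plane := (fun y => c + t • (y - c)) '' closure E with hKdef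
    have hK : IsCompact K := hE.isBounded.isCompact_closure.image (by fun_prop)
    have hKE : K ⊆ E := by
      rintro _ ⟨y, hy, rfl⟩
      exact lineMap_mem_of_mem_closure hρ₀ hstar hy (Ioo_subset_Ico_self htI)
    obtain ⟨r, hr, hrE⟩ := hK.exists_cthickening_subset_open hE.isOpen hKE
    have hrout : 0 < min r (η / 2) := lt_min hr (half_pos hη)
    -- The radius is at most `r`, to keep the mollified function supported in `E`, and at most `η /
    -- 2`, to keep `(t, z)` within `η` of `(1, 0)`.
    let b : ContDiffBump (0 : Plane) :=
      ⟨min r (η / 2) / 2, min r (η / 2), half_pos hrout, half_lt_self hrout⟩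
    set ρ : Plane → ℝ := b.normed volume with hρ
    have hρs : ContDiff ℝ ∞ ρ := b.contDiff_normed
    have hρc : HasCompactSupport ρ := b.hasCompactSupport_normed
    have hρsupp : Function.support ρ ⊆ Metric.closedBall 0 (min r (η / 2)) :=
      b.support_normed_eq.le.trans Metric.ball_subset_closedBall
    set Vt : Plane → ℝ := fun y => V (c + t⁻¹ • (y - c)) with hVt
    set Gt : Plane → Plane := fun y => t⁻¹ • G (c + t⁻¹ • (y - c)) with hGt
    have hVtm : MemLp Vt 2 volume := by
      simpa using memLp_comp_dilation hVm htI c 0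
    have hGtm : MemLp Gt 2 volume := by
      have := (memLp_comp_dilation hGm htI c 0).const_smul t⁻¹
      simp only [sub_zero] at this
      exact this
    have hVtsupp : Function.support Vt ⊆ K := by
      intro y hy
      refine ⟨c + t⁻¹ • (y - c), subset_closure (mem_of_indicator_ne_zero hy), ?_⟩
      simp [smul_smul, mul_inv_cancel₀ htI.1.ne']
    obtain ⟨hφ, hφG⟩ := (hVG.dilation htI.1 c).gradient_mollified hVtm hGtm hρs hρc
    have hsupp := tsupport_mollified_subset hK hrout.le hρsupp hVtsupp
    have hφc : HasCompactSupport (fun y => ∫ z, ρ z • Vt (y - z)) :=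
      (hK.cthickening).of_isClosed_subset (isClosed_tsupport _) hsupp
    have htest := hΔ _ hφ hφc
      (hsupp.trans ((Metric.cthickening_mono (min_le_left _ _) K).trans hrE))
    have i1 : ∫ y, ⟪G y, ∫ z, ρ z • Gt (y - z)⟫ =
        ∫ y in E, ⟪grad v y, gradient (fun y => ∫ z, ρ z • Vt (y - z)) y⟫ := by
      rw [← integral_indicator hmE]
      refine integral_congr_ae (ae_of_all _ fun y => ?_)
      by_cases hy : y ∈ E
      · simp only [hG, indicator_of_mem hy]; rw [hφG]
      · simp [hG, indicator_of_notMem hy]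
    have i2 : ∫ y, ⟪Q y, ∫ z, ρ z • Vt (y - z)⟫ =
        ∫ y in E, q y * ∫ z, ρ z • Vt (y - z) := by
      rw [← integral_indicator hmE]
      refine integral_congr_ae (ae_of_all _ fun y => ?_)
      by_cases hy : y ∈ E
      · simp [hQ, indicator_of_mem hy, mul_comm]
      · simp [hQ, indicator_of_notMem hy]
    have hJt : ∀ z, J (t, z) = (∫ y, ⟪G y, Gt (y - z)⟫) + ∫ y, ⟪Q y, Vt (y - z)⟫ := by
      intro z
      simp only [J, hGt, hVt, real_inner_smul_right, integral_const_mul]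
    have hI : ∀ {F : Type} [NormedAddCommGroup F] [InnerProductSpace ℝ F] {f g : Plane → F},
        MemLp f 2 volume → MemLp g 2 volume →
        Integrable (fun z => ρ z * ∫ y, ⟪g y, f (y - z)⟫) volume := by
      intro F _ _ f g hf hg
      have := (integrable_mollified hρs.continuous hρc hf hg).integral_prod_right
      simpa only [integral_const_mul] using this
    -- A single `J (t, z)` need not vanish, but its `ρ`-average is the equation tested with a
    -- genuine smooth function supported in `E`. As `J` is within `|J₀| / 2` of `J₀` on the support
    -- of `ρ`, this forces `J₀ = 0`.
    have havg : ∫ z, ρ z * J (t, z) = 0 := by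
      simp only [hJt, mul_add]
      rw [integral_add (hI hGtm hGm) (hI hVtm hQm),
        ← integral_inner_mollified hρs.continuous hρc hGtm hGm,
        ← integral_inner_mollified hρs.continuous hρc hVtm hQm, i1, i2, htest]
      ring
    have hρi : Integrable ρ volume := hρs.continuous.integrable_of_hasCompactSupport hρc
    have hJi : Integrable (fun z => ρ z * J (t, z)) volume := by
      simp only [hJt, mul_add]
      exact (hI hGtm hGm).add (hI hVtm hQm)
    have hdiff : ∫ z, ρ z * (J (t, z) - J₀) = -J₀ := by
      simp only [mul_sub]
      rw [integral_sub hJi (hρi.mul_const _), havg, integral_mul_const, b.integral_normed]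
      ring
    have hbound : ‖∫ z, ρ z * (J (t, z) - J₀)‖ ≤ ∫ z, ρ z * (|J₀| / 2) := by
      refine norm_integral_le_of_norm_le (hρi.mul_const _) (ae_of_all _ fun z => ?_)
      rw [norm_mul, Real.norm_of_nonneg (show 0 ≤ ρ z from b.nonneg_normed z)]
      by_cases hz : ρ z = 0
      · simp [hz]
      · refine mul_le_mul_of_nonneg_left ?_ (b.nonneg_normed z)
        have hz2 := hρsupp hz
        rw [mem_closedBall_zero_iff] at hz2
        have hmem : (t, z) ∈ Metric.ball ((1 : ℝ), (0 : Plane)) η ∩ Ioo 0 1 ×ˢ univ := by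
          refine ⟨?_, htI, mem_univ _⟩
          rw [Metric.mem_ball, Prod.dist_eq, max_lt_iff]
          constructor
          · rw [Real.dist_eq, ht, abs_lt]
            constructor <;> linarith [min_le_left η 1]
          · rw [dist_zero_right]
            linarith [min_le_right r (η / 2)]
        exact (hηJ hmem).le
    rw [hdiff, integral_mul_const, b.integral_normed, one_mul, norm_neg, Real.norm_eq_abs] at hbound
    linarith
  have j1 : ∫ y, ⟪G y, G y⟫ = ∫ y in E, ⟪grad v y, grad v y⟫ := by
    rw [← integral_indicator hmE]
    refine integral_congr_ae (ae_of_all _ fun y => ?_)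
    by_cases hy : y ∈ E <;> simp [hG, hy]
  have j2 : ∫ y, ⟪Q y, V y⟫ = ∫ y in E, q y * fn v y := by
    rw [← integral_indicator hmE]
    refine integral_congr_ae (ae_of_all _ fun y => ?_)
    by_cases hy : y ∈ E <;> simp [hQ, hV, hy, mul_comm]
  rw [← j1, ← j2]
  linarith

/-! ### Polynomials -/

lemma contDiff_coord (i : Fin 2) : ContDiff ℝ ∞ (fun y : Plane => y i) :=
  (EuclideanSpace.proj i : Plane →L[ℝ] ℝ).contDiff

lemma polyFun_C (a : ℝ) : polyFun (MvPolynomial.C a) = fun _ => a := by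
  ext; simp [polyFun]

lemma polyFun_add (p q : MvPolynomial (Fin 2) ℝ) : polyFun (p + q) = polyFun p + polyFun q := by
  ext; simp [polyFun]

lemma polyFun_mul_X (p : MvPolynomial (Fin 2) ℝ) (i : Fin 2) :
    polyFun (p * MvPolynomial.X i) = fun y => polyFun p y * y i := by
  ext; simp [polyFun]

lemma contDiff_polyFun (p : MvPolynomial (Fin 2) ℝ) : ContDiff ℝ ∞ (polyFun p) := by
  induction p using MvPolynomial.induction_on with
  | C a => rw [polyFun_C]; exact contDiff_const
  | add p q hp hq => rw [polyFun_add]; exact hp.add hq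
  | mul_X p i hp => rw [polyFun_mul_X]; exact hp.mul (contDiff_coord i)

lemma fderiv_polyFun (p : MvPolynomial (Fin 2) ℝ) (y : Plane) (j : Fin 2) :
    fderiv ℝ (polyFun p) y (EuclideanSpace.single j 1) =
      polyFun (MvPolynomial.pderiv j p) y := by
  have hd : ∀ p, DifferentiableAt ℝ (polyFun p) y := fun p =>
    (contDiff_polyFun p).differentiable (by simp) y
  induction p using MvPolynomial.induction_on with
  | C a =>
    rw [polyFun_C]
    simp [polyFun]
  | add p q hp hq =>
    rw [polyFun_add, fderiv_add (hd p) (hd q), add_apply, hp, hq]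
    simp [polyFun]
  | mul_X p i hp =>
    have hi : HasFDerivAt (fun y : Plane => y i) (EuclideanSpace.proj i : Plane →L[ℝ] ℝ) y :=
      (EuclideanSpace.proj i : Plane →L[ℝ] ℝ).hasFDerivAt
    rw [polyFun_mul_X, fderiv_fun_mul (hd p) hi.differentiableAt, hi.fderiv]
    simp [polyFun] at hp ⊢
    rw [hp]
    by_cases hij : i = j
    · subst hij; simp
    · simp [hij]

/-- The bound `l + 1` is not sharp, but it is the degree up to which the enhancement property tests,
and it needs no separate case `l = 0`. -/
lemma pderiv_mem_poly {l : ℕ} {p : MvPolynomial (Fin 2) ℝ} (hp : p ∈ Poly l) (j : Fin 2) :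
    MvPolynomial.pderiv j p ∈ Poly (l + 1) := by
  rw [MvPolynomial.mem_restrictTotalDegree] at hp ⊢
  rw [MvPolynomial.totalDegree_eq, Finset.sup_le_iff]
  intro m hm
  rw [MvPolynomial.mem_support_iff, MvPolynomial.coeff_pderiv] at hm
  have h := MvPolynomial.le_totalDegree (MvPolynomial.mem_support_iff.2 (left_ne_zero_of_mul hm))
  rw [Finsupp.card_toMultiset, Finsupp.sum_fintype _ _ (fun _ => rfl)]
  rw [Finsupp.sum_fintype _ _ (fun _ => rfl)] at h
  simp only [Finsupp.add_apply, Fin.sum_univ_two, id_eq] at h ⊢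
  omega

/-- Polynomials of degree at most one are affine. -/
lemma exists_affine {p : MvPolynomial (Fin 2) ℝ} (hp : p ∈ Poly 1) :
    ∃ a b c : ℝ, ∀ y, polyFun p y = a + b * y 0 + c * y 1 := by
  refine ⟨p.coeff 0, p.coeff (Finsupp.single 0 1), p.coeff (Finsupp.single 1 1), fun y => ?_⟩
  have hsub : p.support ⊆ {0, Finsupp.single 0 1, Finsupp.single 1 1} := by
    intro m hm
    have h := (MvPolynomial.le_totalDegree hm).trans
      ((MvPolynomial.mem_restrictTotalDegree _ _ _).1 hp)
    rw [Finsupp.sum_fintype _ _ (fun _ => rfl), Fin.sum_univ_two] at h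
    have h2 : (m 0 = 0 ∧ m 1 = 0) ∨ (m 0 = 1 ∧ m 1 = 0) ∨ (m 0 = 0 ∧ m 1 = 1) := by omega
    simp only [Finset.mem_insert, Finset.mem_singleton]
    rcases h2 with h2 | h2 | h2
    · left; ext i; fin_cases i <;> simp [h2.1, h2.2]
    · right; left; ext i; fin_cases i <;> simp [h2.1, h2.2]
    · right; right; ext i; fin_cases i <;> simp [h2.1, h2.2]
  have h01 : (Finsupp.single 0 1 : Fin 2 →₀ ℕ) ≠ Finsupp.single 1 1 := by
    intro h
    simpa using DFunLike.congr_fun h 0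
  rw [polyFun, MvPolynomial.eval_eq, Finset.sum_subset hsub fun m _ hm => by
    rw [MvPolynomial.notMem_support_iff.1 hm, zero_mul],
    Finset.sum_insert (by simp [eq_comm]), Finset.sum_insert (by simpa using h01),
    Finset.sum_singleton]
  simp
  ring

/-- There are `k + 1` monomials of degree `k` in two variables; doubling avoids a division. -/
lemma finrank_poly (l : ℕ) : Module.finrank ℝ (Poly l) * 2 = (l + 1) * (l + 2) := by
  have hset : {n : Fin 2 →₀ ℕ | (n.sum fun _ e => e) ≤ l} =
      ((Finset.range (l + 1)).biUnion fun k => Finset.finsuppAntidiag Finset.univ k :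
        Finset (Fin 2 →₀ ℕ)) := by
    ext n
    simp only [mem_ofPred_eq, Finset.coe_biUnion, mem_iUnion, Finset.mem_coe,
      Finset.mem_finsuppAntidiag, Finsupp.sum_fintype n (fun _ e => e) (fun _ => rfl), Finset.mem_range]
    constructor
    · exact fun h => ⟨_, Nat.lt_succ_of_le h, rfl, Finset.subset_univ _⟩
    · rintro ⟨k, hk, h, -⟩
      exact h.trans_le (Nat.le_of_lt_succ hk)
  have hcard : Module.finrank ℝ (Poly l) =
      ∑ k ∈ Finset.range (l + 1), (k + 1) := by
    rw [Poly, MvPolynomial.restrictTotalDegree, hset,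
      Module.finrank_eq_nat_card_basis (MvPolynomial.basisRestrictSupport ℝ _),
      Nat.card_coe_set_eq, ncard_coe_finset, Finset.card_biUnion]
    · refine Finset.sum_congr rfl fun k _ => ?_
      rw [Finset.card_finsuppAntidiag_nat_eq_choose]
      simp [add_comm]
    · intro a _ b _ hab
      refine Finset.disjoint_left.2 fun n ha hb => ?_
      rw [Finset.mem_finsuppAntidiag] at ha hb
      exact hab (ha.1.symm.trans hb.1)
  have hsum : ∑ k ∈ Finset.range (l + 1), (k + 1) = ∑ k ∈ Finset.range (l + 2), k := by
    rw [Finset.sum_range_succ' (fun k => k) (l + 1), add_zero]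
  rw [hcard, hsum, Finset.sum_range_id_mul_two]
  simp [mul_comm]

lemma finrank_polyField (l : ℕ) : Module.finrank ℝ (Fin 2 → Poly l) = (l + 1) * (l + 2) := by
  rw [Module.finrank_pi_fintype]
  simp only [Finset.sum_const, Finset.card_univ, Fintype.card_fin, smul_eq_mul]
  rw [mul_comm, finrank_poly]

/-! ### A rank argument -/

/-- A family of functionals that factors through `N` parameters, one combination of which is
invisible, but whose common kernel is as small as `N - 1` independent functionals allow, sees
every other combination. -/
lemma exists_smul_of_functional_eq_zero {T P : Type*} [AddCommMonoid T] [Module ℝ T]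
    [AddCommGroup P] [Module ℝ P] [FiniteDimensional ℝ P] {N : ℕ} (β : T →ₗ[ℝ] Module.Dual ℝ P)
    (ev : T →ₗ[ℝ] (Fin N → ℝ)) (hker : ∀ τ, ev τ = 0 → ∀ p, β τ p = 0) {o : T}
    (ho : ev o ≠ 0) (hβo : ∀ p, β o p = 0) {B : Submodule ℝ P}
    (hB : ∀ p, (∀ τ, β τ p = 0) → p ∈ B)
    (hdim : (N : ℤ) - 1 ≤ Module.finrank ℝ P - Module.finrank ℝ B) {τ : T} (hτ : ∀ p, β τ p = 0) :
    ∃ d : ℝ, ev τ = d • ev o := by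
  -- Negation is multiplication by `-1`; it is needed to form the quotient by `ker ev`.
  let _ : AddCommGroup T := Module.addCommMonoidToAddCommGroup ℝ
  -- `β` descends to the finite-dimensional range of `ev`, though `T` itself may be
  -- infinite-dimensional. Neither surjectivity of `ev` nor the dimension of `T` plays a role.
  let β' : LinearMap.range ev →ₗ[ℝ] Module.Dual ℝ P :=
    ((LinearMap.ker ev).liftQ β fun σ hσ => LinearMap.mem_ker.2 (LinearMap.ext
      (hker σ (LinearMap.mem_ker.1 hσ)))).comp ev.quotKerEquivRange.symm.toLinearMap
  have hβ' : ∀ τ, β' ⟨ev τ, τ, rfl⟩ = β τ := by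
    intro τ
    have : ev.quotKerEquivRange.symm ⟨ev τ, τ, rfl⟩ = (LinearMap.ker ev).mkQ τ :=
      ev.quotKerEquivRange.symm_apply_eq.2 rfl
    simp [β', this]
  have h1 := LinearMap.finrank_range_add_finrank_ker β'
  have h2 : Module.finrank ℝ (LinearMap.range ev) ≤ N := by
    simpa using Submodule.finrank_le (LinearMap.range ev)
  -- The common kernel of the functionals lies in `B`, so the rank of `β'` is at least `dim P - dim
  -- B ≥ N - 1`, and its kernel has dimension at most one.
  have h3 : (LinearMap.range β').dualCoannihilator ≤ B := by
    intro p hp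
    refine hB p fun τ => ?_
    rw [← hβ']
    exact (Submodule.mem_dualCoannihilator _).1 hp _ ⟨_, rfl⟩
  have h4 := Submodule.finrank_mono h3
  have h5 := Subspace.finrank_add_finrank_dualCoannihilator_eq (LinearMap.range β')
  let o' : LinearMap.ker β' := ⟨⟨ev o, o, rfl⟩, LinearMap.mem_ker.2 ((hβ' o).trans (LinearMap.ext hβo))⟩
  let τ' : LinearMap.ker β' := ⟨⟨ev τ, τ, rfl⟩, LinearMap.mem_ker.2 ((hβ' τ).trans (LinearMap.ext hτ))⟩
  have ho' : o' ≠ 0 := by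
    intro h
    exact ho (congrArg (fun z : LinearMap.ker β' => (z : LinearMap.range ev).1) h)
  have h6 : 0 < Module.finrank ℝ (LinearMap.ker β') := Module.finrank_pos_iff_exists_ne_zero.2 ⟨o', ho'⟩
  have h7 : Module.finrank ℝ (LinearMap.ker β') = 1 := by omega
  obtain ⟨d, hd⟩ := (finrank_eq_one_iff_of_nonzero' o' ho').1 h7 τ'
  exact ⟨d, (congrArg (fun z : LinearMap.ker β' => (z : LinearMap.range ev).1) hd).symm⟩

/-! ### Linear structure of the virtual element space -/

section
variable {E : Set Plane}

lemma coeFn_fn_add (v w : H1 E) :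
    (fn (v + w) : Plane → ℝ) =ᵐ[volume.restrict E] fun y => fn v y + fn w y :=
  Lp.coeFn_add (fn v) (fn w)

lemma coeFn_fn_smul (a : ℝ) (v : H1 E) :
    (fn (a • v) : Plane → ℝ) =ᵐ[volume.restrict E] fun y => a * fn v y :=
  Lp.coeFn_smul a (fn v)

lemma coeFn_grad_add (v w : H1 E) :
    (grad (v + w) : Plane → Plane) =ᵐ[volume.restrict E] fun y => grad v y + grad w y :=
  Lp.coeFn_add (grad v) (grad w)

lemma coeFn_grad_smul (a : ℝ) (v : H1 E) :
    (grad (a • v) : Plane → Plane) =ᵐ[volume.restrict E] fun y => a • grad v y :=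
  Lp.coeFn_smul a (grad v)

lemma IsPoly.add {k : ℕ} {v w : H1 E} (hv : IsPoly k v) (hw : IsPoly k w) : IsPoly k (v + w) := by
  obtain ⟨p, hp, hpv⟩ := hv
  obtain ⟨q, hq, hqw⟩ := hw
  refine ⟨p + q, add_mem hp hq, ?_⟩
  filter_upwards [coeFn_fn_add v w, hpv, hqw] with y h1 h2 h3
  rw [h1, h2, h3, polyFun_add, Pi.add_apply]

lemma IsPoly.smul {k : ℕ} {v : H1 E} (hv : IsPoly k v) (a : ℝ) : IsPoly k (a • v) := by
  obtain ⟨p, hp, hpv⟩ := hv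
  refine ⟨a • p, Submodule.smul_mem _ a hp, ?_⟩
  filter_upwards [coeFn_fn_smul a v, hpv] with y h1 h2
  rw [h1, h2]
  simp [polyFun, MvPolynomial.smul_eval]

lemma IsPiNabla.add {P₀ : H1 E →L[ℝ] ℝ} {v w v' w' : H1 E} (h : IsPiNabla P₀ v w)
    (h' : IsPiNabla P₀ v' w') : IsPiNabla P₀ (v + v') (w + w') := by
  have he : w + w' - (v + v') = (w - v) + (w' - v') := by abel
  refine ⟨h.1.add h'.1, fun p hp => ?_, ?_⟩
  · rw [he, show grad (w - v + (w' - v')) = grad (w - v) + grad (w' - v') from rfl,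
      inner_add_left, h.2.1 p hp, h'.2.1 p hp, add_zero]
  · rw [he, map_add, h.2.2, h'.2.2, add_zero]

lemma IsPiNabla.smul {P₀ : H1 E →L[ℝ] ℝ} {v w : H1 E} (h : IsPiNabla P₀ v w) (a : ℝ) :
    IsPiNabla P₀ (a • v) (a • w) := by
  have he : a • w - a • v = a • (w - v) := (smul_sub a w v).symm
  refine ⟨h.1.smul a, fun p hp => ?_, ?_⟩
  · rw [he, show grad (a • (w - v)) = a • grad (w - v) from rfl, real_inner_smul_left,
      h.2.1 p hp, mul_zero]
  · rw [he, map_smul, h.2.2, smul_zero]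

lemma integral_fn_add_mul (v w : H1 E) {q : Plane → ℝ} (hq : MemLp q 2 (volume.restrict E)) :
    ∫ y in E, fn (v + w) y * q y = (∫ y in E, fn v y * q y) + ∫ y in E, fn w y * q y := by
  refine (integral_congr_ae ((coeFn_fn_add v w).mono fun y hy => ?_)).trans
    (integral_add ((Lp.memLp (fn v)).integrable_mul hq) ((Lp.memLp (fn w)).integrable_mul hq))
  simp only [hy]
  ring

lemma integral_fn_smul_mul (a : ℝ) (v : H1 E) (q : Plane → ℝ) :
    ∫ y in E, fn (a • v) y * q y = a * ∫ y in E, fn v y * q y := by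
  rw [← integral_const_mul]
  refine integral_congr_ae ((coeFn_fn_smul a v).mono fun y hy => ?_)
  simp only [hy]
  ring

lemma enhanced_add (hE : IsOpen E) (hb : Bornology.IsBounded E) {P₀ : H1 E →L[ℝ] ℝ} {l : ℕ}
    {v w : H1 E} (hv : v ∈ enhanced P₀ l) (hw : w ∈ enhanced P₀ l) : v + w ∈ enhanced P₀ l := by
  obtain ⟨v', hv', hv⟩ := hv
  obtain ⟨w', hw', hw⟩ := hw
  refine ⟨v' + w', hv'.add hw', fun p hp => ?_⟩
  have hm := memLp_of_continuous hb hE (continuous_polyFun p)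
  rw [integral_fn_add_mul v w hm, integral_fn_add_mul v' w' hm, hv p hp, hw p hp]

lemma enhanced_smul {P₀ : H1 E →L[ℝ] ℝ} {l : ℕ} {v : H1 E} (hv : v ∈ enhanced P₀ l) (a : ℝ) :
    a • v ∈ enhanced P₀ l := by
  obtain ⟨v', hv', hv⟩ := hv
  refine ⟨a • v', hv'.smul a, fun p hp => ?_⟩
  rw [integral_fn_smul_mul, integral_fn_smul_mul, hv p hp]

lemma HasWeakLaplacian.add (hE : IsOpen E) (hb : Bornology.IsBounded E) {v w : H1 E}
    {q r : Plane → ℝ} (hq : Continuous q) (hr : Continuous r) (hv : HasWeakLaplacian v q)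
    (hw : HasWeakLaplacian w r) : HasWeakLaplacian (v + w) (q + r) := by
  intro φ hφ hc hs
  have hg := memLp_gradient_test hφ hc E
  have hm := memLp_test hφ hc E
  have h1 : ∫ y in E, ⟪grad (v + w) y, gradient φ y⟫ =
      (∫ y in E, ⟪grad v y, gradient φ y⟫) + ∫ y in E, ⟪grad w y, gradient φ y⟫ := by
    rw [← integral_add (integrable_inner_of_memLp (Lp.memLp _) hg)
      (integrable_inner_of_memLp (Lp.memLp _) hg)]
    refine integral_congr_ae ((coeFn_grad_add v w).mono fun y hy => ?_)
    simp only [hy, inner_add_left]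
  have h2 : ∫ y in E, (q + r) y * φ y = (∫ y in E, q y * φ y) + ∫ y in E, r y * φ y := by
    refine (integral_congr_ae (ae_of_all _ fun y => ?_)).trans
      (integral_add ((memLp_of_continuous hb hE hq).integrable_mul hm)
        ((memLp_of_continuous hb hE hr).integrable_mul hm))
    simp only [Pi.add_apply]
    ring
  rw [h1, h2, hv φ hφ hc hs, hw φ hφ hc hs, neg_add]

lemma HasWeakLaplacian.smul {v : H1 E} {q : Plane → ℝ} (hv : HasWeakLaplacian v q) (a : ℝ) :
    HasWeakLaplacian (a • v) (a • q) := by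
  intro φ hφ hc hs
  have h1 : ∫ y in E, ⟪grad (a • v) y, gradient φ y⟫ =
      a * ∫ y in E, ⟪grad v y, gradient φ y⟫ := by
    rw [← integral_const_mul]
    refine integral_congr_ae ((coeFn_grad_smul a v).mono fun y hy => ?_)
    simp only [hy, real_inner_smul_left]
  have h2 : ∫ y in E, (a • q) y * φ y = a * ∫ y in E, q y * φ y := by
    rw [← integral_const_mul]
    refine integral_congr_ae (ae_of_all _ fun y => ?_)
    simp only [Pi.smul_apply, smul_eq_mul]
    ring
  rw [h1, h2, hv φ hφ hc hs, mul_neg]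

end

/-! ### Linearity of the trace relation -/

lemma tendsto_eLpNorm_add {α F : Type*} [MeasurableSpace α] {μ : Measure α}
    [NormedAddCommGroup F] {f f' h : ℕ → α → F} {g g' k : α → F}
    (hf : ∀ n, MemLp (f n) 2 μ) (hf' : ∀ n, MemLp (f' n) 2 μ) (hg : MemLp g 2 μ)
    (hg' : MemLp g' 2 μ)
    (h1 : Tendsto (fun n => eLpNorm (fun y => f n y - g y) 2 μ) atTop (𝓝 0))
    (h2 : Tendsto (fun n => eLpNorm (fun y => f' n y - g' y) 2 μ) atTop (𝓝 0))
    (hh : ∀ n, h n =ᵐ[μ] f n + f' n) (hk : k =ᵐ[μ] g + g') :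
    Tendsto (fun n => eLpNorm (fun y => h n y - k y) 2 μ) atTop (𝓝 0) := by
  have h3 := h1.add h2
  rw [add_zero] at h3
  refine tendsto_of_tendsto_of_tendsto_of_le_of_le tendsto_const_nhds h3 (fun _ => zero_le)
    fun n => ?_
  have : eLpNorm (fun y => h n y - k y) 2 μ =
      eLpNorm ((fun y => f n y - g y) + fun y => f' n y - g' y) 2 μ := by
    refine eLpNorm_congr_ae ?_
    filter_upwards [hh n, hk] with y e1 e2
    rw [e1, e2]
    simp only [Pi.add_apply]
    abel
  rw [this]
  exact eLpNorm_add_le ((hf n).sub hg).1 ((hf' n).sub hg').1 (by norm_num)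

lemma tendsto_eLpNorm_smul {α F : Type*} [MeasurableSpace α] {μ : Measure α}
    [NormedAddCommGroup F] [NormedSpace ℝ F] {f h : ℕ → α → F} {g k : α → F} (a : ℝ)
    (h1 : Tendsto (fun n => eLpNorm (fun y => f n y - g y) 2 μ) atTop (𝓝 0))
    (hh : ∀ n, h n =ᵐ[μ] a • f n) (hk : k =ᵐ[μ] a • g) :
    Tendsto (fun n => eLpNorm (fun y => h n y - k y) 2 μ) atTop (𝓝 0) := by
  have h3 := ENNReal.Tendsto.const_mul (a := ‖a‖ₑ) h1 (Or.inr enorm_ne_top)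
  rw [mul_zero] at h3
  refine h3.congr fun n => ?_
  rw [← eLpNorm_const_smul]
  refine eLpNorm_congr_ae ?_
  filter_upwards [hh n, hk] with y e1 e2
  rw [e1, e2]
  simp [smul_sub]

lemma gradient_add {f g : Plane → ℝ} (hf : ContDiff ℝ ∞ f) (hg : ContDiff ℝ ∞ g) :
    gradient (f + g) = gradient f + gradient g := by
  ext1 y
  simp only [gradient, Pi.add_apply]
  rw [fderiv_add (hf.differentiable (by simp) y) (hg.differentiable (by simp) y), map_add]

lemma gradient_smul {f : Plane → ℝ} (hf : ContDiff ℝ ∞ f) (a : ℝ) :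
    gradient (a • f) = a • gradient f := by
  ext1 y
  simp only [gradient, Pi.smul_apply]
  rw [fderiv_const_smul (hf.differentiable (by simp) y), map_smul]

section
variable {N : ℕ} {x : Fin N → Plane} {E : Set Plane}

lemma IsTrace.add (hE : IsOpen E) (hb : Bornology.IsBounded E) {v w : H1 E} {g h : Plane → ℝ}
    (hg : IsTrace x v g) (hh : IsTrace x w h) : IsTrace x (v + w) (g + h) := by
  obtain ⟨hgm, f, hf, f1, f2, f3⟩ := hg
  obtain ⟨hhm, k, hk, k1, k2, k3⟩ := hh
  refine ⟨hgm.add hhm, fun n => f n + k n, fun n => (hf n).add (hk n), ?_, ?_, ?_⟩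
  · exact tendsto_eLpNorm_add (fun n => memLp_of_continuous hb hE (hf n).continuous)
      (fun n => memLp_of_continuous hb hE (hk n).continuous) (Lp.memLp _) (Lp.memLp _) f1 k1
      (fun _ => .rfl) (coeFn_fn_add v w)
  · exact tendsto_eLpNorm_add (fun n => memLp_of_continuous hb hE (continuous_gradient (hf n)))
      (fun n => memLp_of_continuous hb hE (continuous_gradient (hk n))) (Lp.memLp _) (Lp.memLp _)
      f2 k2 (fun n => by rw [gradient_add (hf n) (hk n)]) (coeFn_grad_add v w)
  · exact tendsto_eLpNorm_add (fun n => memLp_boundaryMeasure x (hf n).continuous)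
      (fun n => memLp_boundaryMeasure x (hk n).continuous) hgm hhm f3 k3 (fun _ => .rfl) .rfl

lemma IsTrace.smul {v : H1 E} {g : Plane → ℝ} (hg : IsTrace x v g) (a : ℝ) :
    IsTrace x (a • v) (a • g) := by
  obtain ⟨hgm, f, hf, f1, f2, f3⟩ := hg
  refine ⟨hgm.const_smul a, fun n => a • f n, fun n => contDiff_const.smul (hf n), ?_, ?_, ?_⟩
  · exact tendsto_eLpNorm_smul a f1 (fun _ => .rfl) (coeFn_fn_smul a v)
  · exact tendsto_eLpNorm_smul a f2 (fun n => by rw [gradient_smul (hf n)]) (coeFn_grad_smul a v)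
  · exact tendsto_eLpNorm_smul a f3 (fun _ => .rfl) .rfl

lemma IsTrace.congr {v : H1 E} {g h : Plane → ℝ} (hg : IsTrace x v g)
    (hgh : g =ᵐ[boundaryMeasure x] h) : IsTrace x v h := by
  obtain ⟨hgm, f, hf, f1, f2, f3⟩ := hg
  refine ⟨(memLp_congr_ae hgh).1 hgm, f, hf, f1, f2, f3.congr fun n => eLpNorm_congr_ae ?_⟩
  filter_upwards [hgh] with y hy
  rw [hy]

/-- A function with piecewise affine trace on the boundary of a polygon, together with its trace. -/
structure IsVirtualPair (x : Fin N → Plane) (P₀ : H1 E →L[ℝ] ℝ) (l : ℕ)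
    (τ : H1 E × (Plane → ℝ)) : Prop where
  enhanced : τ.1 ∈ enhanced P₀ l
  laplacian : ∃ q ∈ Poly (l + 1), HasWeakLaplacian τ.1 (polyFun q)
  trace : IsTrace x τ.1 τ.2
  continuousOn : ContinuousOn τ.2 (frontier E)
  affine : ∀ i, ∃ p ∈ Poly 1, EqOn τ.2 (polyFun p) (edge x i)

/-- A trace is determined only almost everywhere, so it has no values at vertices. Carrying a chosen
piecewise affine representative along makes the vertex values a linear map. -/
lemma mem_virtualSpace_iff {P₀ : H1 E →L[ℝ] ℝ} {l : ℕ} {v : H1 E} :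
    v ∈ virtualSpace x P₀ l ↔ ∃ g, IsVirtualPair x P₀ l (v, g) :=
  ⟨fun ⟨h1, h2, g, h3, h4, h5⟩ => ⟨g, h1, h2, h3, h4, h5⟩,
    fun ⟨g, h1, h2, h3, h4, h5⟩ => ⟨h1, h2, g, h3, h4, h5⟩⟩

lemma polyFun_smul (a : ℝ) (p : MvPolynomial (Fin 2) ℝ) : polyFun (a • p) = a • polyFun p := by
  ext; simp [polyFun, MvPolynomial.smul_eval]

lemma IsVirtualPair.add (hE : IsOpen E) (hb : Bornology.IsBounded E) {P₀ : H1 E →L[ℝ] ℝ} {l : ℕ}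
    {τ σ : H1 E × (Plane → ℝ)} (hτ : IsVirtualPair x P₀ l τ) (hσ : IsVirtualPair x P₀ l σ) :
    IsVirtualPair x P₀ l (τ + σ) where
  enhanced := enhanced_add hE hb hτ.enhanced hσ.enhanced
  laplacian := by
    obtain ⟨q, hq, h1⟩ := hτ.laplacian
    obtain ⟨r, hr, h2⟩ := hσ.laplacian
    refine ⟨q + r, add_mem hq hr, ?_⟩
    rw [polyFun_add]
    exact h1.add hE hb (continuous_polyFun q) (continuous_polyFun r) h2
  trace := hτ.trace.add hE hb hσ.trace
  continuousOn := hτ.continuousOn.add hσ.continuousOn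
  affine i := by
    obtain ⟨q, hq, h1⟩ := hτ.affine i
    obtain ⟨r, hr, h2⟩ := hσ.affine i
    refine ⟨q + r, add_mem hq hr, fun y hy => ?_⟩
    rw [polyFun_add, Prod.snd_add, Pi.add_apply, Pi.add_apply, h1 hy, h2 hy]

lemma IsVirtualPair.smul {P₀ : H1 E →L[ℝ] ℝ} {l : ℕ}
    {τ : H1 E × (Plane → ℝ)} (hτ : IsVirtualPair x P₀ l τ) (a : ℝ) :
    IsVirtualPair x P₀ l (a • τ) where
  enhanced := enhanced_smul hτ.enhanced a
  laplacian := by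
    obtain ⟨q, hq, h1⟩ := hτ.laplacian
    refine ⟨a • q, Submodule.smul_mem _ a hq, ?_⟩
    rw [polyFun_smul]
    exact h1.smul a
  trace := hτ.trace.smul a
  continuousOn := hτ.continuousOn.const_smul a
  affine i := by
    obtain ⟨q, hq, h1⟩ := hτ.affine i
    refine ⟨a • q, Submodule.smul_mem _ a hq, fun y hy => ?_⟩
    rw [polyFun_smul, Prod.smul_snd, Pi.smul_apply, Pi.smul_apply, h1 hy]

/-- The constant function `1`, with its trace. -/
def onePair {κ : ℝ} (hE : IsPolygon x E) (hreg : IsRegular κ x E) : H1 E × (Plane → ℝ) :=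
  (ofSmooth hE hreg (contDiff_const (c := (1 : ℝ))), fun _ => 1)

lemma fn_onePair {κ : ℝ} (hE : IsPolygon x E) (hreg : IsRegular κ x E) :
    (fn (onePair hE hreg).1 : Plane → ℝ) =ᵐ[volume.restrict E] fun _ => 1 :=
  fn_ofSmooth hE hreg contDiff_const

lemma grad_onePair {κ : ℝ} (hE : IsPolygon x E) (hreg : IsRegular κ x E) :
    grad (onePair hE hreg).1 = 0 := by
  refine Lp.ext ((grad_ofSmooth hE hreg contDiff_const).trans ?_)
  filter_upwards [Lp.coeFn_zero Plane 2 (volume.restrict E)] with y hy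
  rw [hy]
  simp [gradient]

lemma isVirtualPair_onePair {κ : ℝ} (hE : IsPolygon x E) (hreg : IsRegular κ x E)
    (P₀ : H1 E →L[ℝ] ℝ) (l : ℕ) : IsVirtualPair x P₀ l (onePair hE hreg) where
  enhanced := by
    refine ⟨(onePair hE hreg).1, ⟨⟨MvPolynomial.C 1, ?_, ?_⟩, fun p _ => ?_, by simp⟩,
      fun _ _ => rfl⟩
    · simp [MvPolynomial.mem_restrictTotalDegree]
    · rw [polyFun_C]
      exact fn_onePair hE hreg
    · rw [sub_self, show grad (0 : H1 E) = 0 from rfl, inner_zero_left]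
  laplacian := by
    refine ⟨0, zero_mem _, fun φ _ _ _ => ?_⟩
    have h0 : polyFun 0 = fun _ => 0 := by ext; simp [polyFun]
    rw [grad_onePair, h0]
    simp only [zero_mul, integral_zero, neg_zero]
    refine integral_eq_zero_of_ae ?_
    filter_upwards [Lp.coeFn_zero Plane 2 (volume.restrict E)] with y hy
    rw [hy, Pi.zero_apply, inner_zero_left, Pi.zero_apply]
  trace := isTrace_ofSmooth hE hreg contDiff_const
  continuousOn := continuousOn_const
  affine i := ⟨MvPolynomial.C 1, by simp [MvPolynomial.mem_restrictTotalDegree],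
    fun y _ => by rw [polyFun_C]; rfl⟩

/-- The space of functions in the virtual element space, together with their traces. -/
def virtualPairs {κ : ℝ} (hE : IsPolygon x E) (hreg : IsRegular κ x E) (P₀ : H1 E →L[ℝ] ℝ)
    (l : ℕ) : Submodule ℝ (H1 E × (Plane → ℝ)) where
  carrier := {τ | IsVirtualPair x P₀ l τ}
  zero_mem' := by
    have := (isVirtualPair_onePair hE hreg P₀ l).smul 0
    rwa [zero_smul] at this
  add_mem' h h' := h.add hE.isOpen hE.isBounded h'
  smul_mem' a _ h := h.smul a

/-- A function in the virtual element space that vanishes at the vertices has zero trace. -/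
lemma IsVirtualPair.trace_zero {P₀ : H1 E →L[ℝ] ℝ} {l : ℕ} {τ : H1 E × (Plane → ℝ)}
    (hτ : IsVirtualPair x P₀ l τ) (h : ∀ i, τ.2 (x i) = 0) : IsTrace x τ.1 0 := by
  refine hτ.trace.congr (ae_boundaryMeasure fun i y hy => ?_)
  obtain ⟨p, hp, hpe⟩ := hτ.affine i
  obtain ⟨a, b, c, habc⟩ := exists_affine hp
  have h0 : polyFun p (x i) = 0 := by
    rw [← hpe (left_mem_segment ℝ _ _), h]
  have h1 : polyFun p (nextVertex x i) = 0 := by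
    rw [← hpe (right_mem_segment ℝ _ _), nextVertex, h]
  rw [hpe hy, habc]
  rw [edge, segment_eq_image_lineMap] at hy
  obtain ⟨t, -, rfl⟩ := hy
  rw [habc] at h0 h1
  simp only [AffineMap.lineMap_apply_module, PiLp.add_apply, PiLp.smul_apply, smul_eq_mul,
    Pi.zero_apply]
  linear_combination (1 - t) * h0 + t * h1

end

/-! ### Fluxes of polynomial fields -/

section
variable {N : ℕ} {x : Fin N → Plane} {E : Set Plane} {κ : ℝ}

/-- Green's formula for a polynomial field. -/
lemma IsTrace.flux (hE : IsPolygon x E) (hreg : IsRegular κ x E) {v : H1 E} {g : Plane → ℝ}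
    (hg : IsTrace x v g) {l : ℕ} (p : Fin 2 → Poly l) :
    ∑ i, ∫ y, ⟪polyField p y, normal x i⟫ * g y ∂(edgeMeasure x i) =
      (∫ y in E, ⟪grad v y, polyField p y⟫) +
        ∑ j, ∫ y in E, fn v y * polyFun (MvPolynomial.pderiv j (p j)) y := by
  have hgreen := fun j : Fin 2 => hg.green hE hreg
    ((contDiff_polyFun (p j)).of_le (by simp)) (EuclideanSpace.single j (1 : ℝ))
  have hsum := Finset.sum_congr rfl fun j (_ : j ∈ Finset.univ) => hgreen j
  rw [Finset.sum_add_distrib, Finset.sum_comm] at hsum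
  have h1 : ∫ y in E, ⟪grad v y, polyField p y⟫ = ∑ j : Fin 2, ∫ y in E,
      ⟪grad v y, polyFun (p j) y • EuclideanSpace.single j (1 : ℝ)⟫ := by
    refine (integral_congr_ae (ae_of_all _ fun y => ?_)).trans
      (integral_finsetSum _ fun j _ => integrable_inner_of_memLp (Lp.memLp (grad v))
        (memLp_of_continuous hE.isBounded hE.isOpen
          ((continuous_polyFun (p j)).smul continuous_const)))
    simp only [← inner_sum]
    congr 1
    ext i
    fin_cases i <;> simp [polyField]
  have h2 : ∀ j : Fin 2, ∫ y in E, fn v y * polyFun (MvPolynomial.pderiv j (p j)) y =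
      ∫ y in E, ⟪fn v y, fderiv ℝ (polyFun (p j)) y (EuclideanSpace.single j (1 : ℝ))⟫ := by
    intro j
    refine integral_congr_ae (ae_of_all _ fun y => ?_)
    simp only [fderiv_polyFun]
    simp [mul_comm]
  have h3 : ∀ i, ∫ y, ⟪polyField p y, normal x i⟫ * g y ∂(edgeMeasure x i) =
      ∑ j, ⟪normal x i, EuclideanSpace.single j (1 : ℝ)⟫ *
        ∫ y, ⟪g y, polyFun (p j) y⟫ ∂(edgeMeasure x i) := by
    intro i
    simp only [← integral_const_mul]
    rw [← integral_finsetSum _ fun j _ => ((integrable_inner_of_memLp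
      (hg.1.mono_measure (edgeMeasure_le x i)) ((memLp_boundaryMeasure x
        (continuous_polyFun (p j))).mono_measure (edgeMeasure_le x i))).const_mul _)]
    refine integral_congr_ae (ae_of_all _ fun y => ?_)
    simp [EuclideanSpace.inner_eq_star_dotProduct, dotProduct, Fin.sum_univ_two, polyField]
    ring
  rw [Finset.sum_congr rfl fun i _ => h3 i, h1, Finset.sum_congr rfl fun j _ => h2 j]
  exact hsum.symm

lemma IsTrace.sub_const (hE : IsPolygon x E) (hreg : IsRegular κ x E) {v : H1 E} {g : Plane → ℝ}
    (hg : IsTrace x v g) (c : ℝ) :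
    IsTrace x (v + (-c) • (onePair hE hreg).1) (fun y => g y - c) := by
  have h := hg.add hE.isOpen hE.isBounded
    ((isTrace_ofSmooth hE hreg (contDiff_const (c := (1 : ℝ)))).smul (-c))
  have hfun : (fun y => g y - c) = g + (-c) • fun _ => (1 : ℝ) := by
    ext y
    simp [sub_eq_add_neg]
  rw [hfun]
  exact h

/-- The flux functional of a function in the virtual element space, given with its trace. -/
def fluxForm (hE : IsPolygon x E) (hreg : IsRegular κ x E) (P₀ : H1 E →L[ℝ] ℝ) (l : ℕ) :
    virtualPairs hE hreg P₀ l →ₗ[ℝ] Module.Dual ℝ (Fin 2 → Poly l) :=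
  LinearMap.mk₂ ℝ (fun τ p => ∑ i, ∫ y, ⟪polyField p y, normal x i⟫ * (τ.1.2 y - P₀ τ.1.1)
      ∂(edgeMeasure x i))
    (fun τ σ p => by
      rw [← Finset.sum_add_distrib]
      refine Finset.sum_congr rfl fun i _ => ?_
      refine Eq.trans ?_ (integral_add (integrable_edge x p τ.2.trace.1 _ i)
        (integrable_edge x p σ.2.trace.1 _ i))
      refine integral_congr_ae (ae_of_all _ fun y => ?_)
      simp
      ring)
    (fun a τ p => by
      rw [smul_eq_mul, Finset.mul_sum]
      refine Finset.sum_congr rfl fun i _ => ?_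
      rw [← integral_const_mul]
      refine integral_congr_ae (ae_of_all _ fun y => ?_)
      simp
      ring)
    (fun τ p q => by
      rw [← Finset.sum_add_distrib]
      refine Finset.sum_congr rfl fun i _ => ?_
      refine Eq.trans ?_ (integral_add (integrable_edge x p τ.2.trace.1 _ i)
        (integrable_edge x q τ.2.trace.1 _ i))
      refine integral_congr_ae (ae_of_all _ fun y => ?_)
      simp [polyField_add, inner_add_left, add_mul])
    (fun a τ p => by
      rw [smul_eq_mul, Finset.mul_sum]
      refine Finset.sum_congr rfl fun i _ => ?_
      rw [← integral_const_mul]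
      refine integral_congr_ae (ae_of_all _ fun y => ?_)
      simp [polyField_smul, real_inner_smul_left, mul_assoc])

lemma fluxForm_apply (hE : IsPolygon x E) (hreg : IsRegular κ x E) (P₀ : H1 E →L[ℝ] ℝ) (l : ℕ)
    (τ : virtualPairs hE hreg P₀ l) (p : Fin 2 → Poly l) :
    fluxForm hE hreg P₀ l τ p = ∑ i, ∫ y, ⟪polyField p y, normal x i⟫ * (τ.1.2 y - P₀ τ.1.1)
      ∂(edgeMeasure x i) := rfl

/-- The flux does not depend on the choice of the trace. -/
lemma IsTrace.flux_eq (hE : IsPolygon x E) (hreg : IsRegular κ x E) {v : H1 E}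
    {g g' : Plane → ℝ} (hg : IsTrace x v g) (hg' : IsTrace x v g') (c : ℝ) {l : ℕ}
    (p : Fin 2 → Poly l) :
    ∑ i, ∫ y, ⟪polyField p y, normal x i⟫ * (g y - c) ∂(edgeMeasure x i) =
      ∑ i, ∫ y, ⟪polyField p y, normal x i⟫ * (g' y - c) ∂(edgeMeasure x i) :=
  -- Both boundary sums equal the same integral over `E`, which does not involve the trace.
  ((hg.sub_const hE hreg c).flux hE hreg p).trans
    ((hg'.sub_const hE hreg c).flux hE hreg p).symm

/-- The values at the vertices. -/
def vertexValues (hE : IsPolygon x E) (hreg : IsRegular κ x E) (P₀ : H1 E →L[ℝ] ℝ) (l : ℕ) :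
    virtualPairs hE hreg P₀ l →ₗ[ℝ] (Fin N → ℝ) where
  toFun τ i := τ.1.2 (x i)
  map_add' _ _ := rfl
  map_smul' _ _ := rfl

/-- Zero vertex values give a zero trace, and `hdof` removes the remaining term `P₀ v`. So the flux
factors through the vertex values, as the rank argument requires. -/
lemma fluxForm_eq_zero_of_vertexValues_eq_zero (hE : IsPolygon x E) (hreg : IsRegular κ x E)
    {P₀ : H1 E →L[ℝ] ℝ} {l : ℕ} (hdof : ∀ v ∈ virtualSpace x P₀ l, IsTrace x v 0 → P₀ v = 0)
    (σ : virtualPairs hE hreg P₀ l) (hσ : vertexValues hE hreg P₀ l σ = 0) (p : Fin 2 → Poly l) :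
    fluxForm hE hreg P₀ l σ p = 0 := by
  have hz : IsTrace x σ.1.1 0 := σ.2.trace_zero fun i => congrFun hσ i
  have hP := hdof σ.1.1 (mem_virtualSpace_iff.2 ⟨σ.1.2, σ.2⟩) hz
  rw [fluxForm_apply, σ.2.trace.flux_eq hE hreg hz, hP]
  simp

/-- `badPoly` tests every trace of `v`, `fluxForm` only the piecewise affine ones; independence of
the representative bridges the two. -/
lemma mem_badPoly_of_fluxForm (hE : IsPolygon x E) (hreg : IsRegular κ x E)
    {P₀ : H1 E →L[ℝ] ℝ} {l : ℕ} {p : Fin 2 → Poly l}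
    (hp : ∀ σ, fluxForm hE hreg P₀ l σ p = 0) : p ∈ badPoly x P₀ l := by
  intro v hv g' hg'
  obtain ⟨k, hk⟩ := mem_virtualSpace_iff.1 hv
  rw [hg'.flux_eq hE hreg hk.trace]
  exact hp ⟨(v, k), hk⟩

/-- The constant function `1`, as an element of the space of virtual pairs. -/
def oneVirtual (hE : IsPolygon x E) (hreg : IsRegular κ x E) (P₀ : H1 E →L[ℝ] ℝ) (l : ℕ) :
    virtualPairs hE hreg P₀ l := ⟨onePair hE hreg, isVirtualPair_onePair hE hreg P₀ l⟩

lemma vertexValues_oneVirtual (hE : IsPolygon x E) (hreg : IsRegular κ x E)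
    (P₀ : H1 E →L[ℝ] ℝ) (l : ℕ) (i : Fin N) :
    vertexValues hE hreg P₀ l (oneVirtual hE hreg P₀ l) i = 1 := rfl

lemma fluxForm_oneVirtual (hE : IsPolygon x E) (hreg : IsRegular κ x E) {P₀ : H1 E →L[ℝ] ℝ}
    (hP₀ : IsConstProjection P₀) (l : ℕ) (p : Fin 2 → Poly l) :
    fluxForm hE hreg P₀ l (oneVirtual hE hreg P₀ l) p = 0 := by
  rw [fluxForm_apply]
  refine Finset.sum_eq_zero fun i _ => ?_
  have : ∀ y, (onePair hE hreg).2 y - P₀ (onePair hE hreg).1 = 0 := fun y => by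
    rw [hP₀ 1 _ (fn_onePair hE hreg)]
    exact sub_self 1
  simp only [oneVirtual, this, mul_zero, integral_zero]

/-! ### The projection of the gradient -/

lemma integral_inner_polyField_eq_zero (hE : IsPolygon x E) {l : ℕ} {F : L2Vec E}
    (hF : piZero l F = 0) (p : Fin 2 → Poly l) : ∫ y in E, ⟪F y, polyField p y⟫ = 0 := by
  have hm := memLp_of_continuous hE.isBounded hE.isOpen (continuous_polyField p)
  have h := Submodule.inner_left_of_mem_orthogonal (K := polyL2 E l) (u := hm.toLp (polyField p))
    ⟨p, hm.coeFn_toLp⟩ ((Submodule.starProjection_apply_eq_zero_iff _).1 hF)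
  rw [← h, L2.inner_def]
  refine integral_congr_ae (hm.coeFn_toLp.mono fun y hy => ?_)
  simp only [hy]

lemma gradient_affine {f : Plane → ℝ} {a b c : ℝ} (hf : ∀ y, f y = a + b * y 0 + c * y 1)
    (y : Plane) : gradient f y = !₂[b, c] := by
  have hfun : f = fun y => a + innerSL ℝ (!₂[b, c] : Plane) y := by
    ext y
    rw [hf, innerSL_apply_apply, EuclideanSpace.inner_eq_star_dotProduct]
    simp [dotProduct, Fin.sum_univ_two]
    ring
  refine ext_inner_right ℝ fun e => ?_
  rw [inner_gradient, hfun, fderiv_const_add, ContinuousLinearMap.fderiv]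
  rfl

/-- If `Π⁰_l ∇w = 0` and `P₀ w = 0`, then `w` is orthogonal to the polynomials of degree at most
`l + 1`. -/
lemma integral_mul_polyFun_eq_zero (hE : IsPolygon x E) (hreg : IsRegular κ x E)
    {P₀ : H1 E →L[ℝ] ℝ} (hP₀ : IsConstProjection P₀) {l : ℕ} {w : H1 E} (hw : w ∈ enhanced P₀ l)
    (hproj : piZero l (grad w) = 0) (hw0 : P₀ w = 0) {q : MvPolynomial (Fin 2) ℝ}
    (hq : q ∈ Poly (l + 1)) : ∫ y in E, fn w y * polyFun q y = 0 := by
  obtain ⟨z, ⟨⟨p, hp, hzp⟩, horth, hz0⟩, hz⟩ := hw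
  obtain ⟨a, b, c, habc⟩ := exists_affine hp
  have hgz : (grad z : Plane → Plane) =ᵐ[volume.restrict E] fun _ => !₂[b, c] :=
    (grad_eq_gradient_of_fn_eq hE hreg z (contDiff_polyFun p) hzp).trans
      (ae_of_all _ fun y => gradient_affine habc y)
  have hmem : grad z ∈ polyL2 E l := by
    have hC : ∀ a : ℝ, MvPolynomial.C a ∈ Poly l := fun a => by
      simp [MvPolynomial.mem_restrictTotalDegree]
    refine ⟨![⟨_, hC b⟩, ⟨_, hC c⟩], hgz.trans (ae_of_all _ fun y => ?_)⟩
    ext i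
    fin_cases i <;> simp [polyField, polyFun]
  -- `z = Π^∇₁ w` is itself an admissible affine test function, and its constant gradient lies in
  -- `[ℙ_l]²` even for `l = 0`.
  have hgz0 : grad z = 0 := by
    have h1 : ⟪grad w, grad z⟫ = 0 :=
      Submodule.inner_left_of_mem_orthogonal hmem
        ((Submodule.starProjection_apply_eq_zero_iff _).1 hproj)
    have h2 := horth z ⟨p, hp, hzp⟩
    rw [show grad (z - w) = grad z - grad w from rfl, inner_sub_left, h1, sub_zero] at h2
    exact inner_self_eq_zero.1 h2
  -- `E` has positive measure, so constants that agree almost everywhere on it are equal.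
  have hne : NeBot (ae (volume.restrict E)) := by
    obtain ⟨c, ρ, hρ, -, hball, -⟩ := hreg.starShaped
    rw [ae_neBot, Ne, Measure.restrict_eq_zero]
    exact (hE.isOpen.measure_pos volume ⟨c, hball (Metric.mem_ball_self hρ)⟩).ne'
  have hbc : (!₂[b, c] : Plane) = 0 := by
    rw [hgz0] at hgz
    obtain ⟨y, h1, h2⟩ := (hgz.and (Lp.coeFn_zero Plane 2 (volume.restrict E))).exists
    exact h1.symm.trans h2
  have hb : b = 0 := by simpa using congrArg (fun y : Plane => y 0) hbc
  have hc : c = 0 := by simpa using congrArg (fun y : Plane => y 1) hbc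
  have hza : (fn z : Plane → ℝ) =ᵐ[volume.restrict E] fun _ => a :=
    hzp.trans (ae_of_all _ fun y => by simp [habc, hb, hc])
  have ha : a = 0 := by
    rw [map_sub, hw0, sub_zero, hP₀ a z hza] at hz0
    exact hz0
  rw [hz q hq]
  refine integral_eq_zero_of_ae (hza.mono fun y hy => ?_)
  simp [hy, ha]

lemma grad_add_smul_onePair (hE : IsPolygon x E) (hreg : IsRegular κ x E) (v : H1 E) (a : ℝ) :
    grad (v + a • (onePair hE hreg).1) = grad v := by
  rw [show grad (v + a • (onePair hE hreg).1) = grad v + a • grad (onePair hE hreg).1 from rfl,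
    grad_onePair, smul_zero, add_zero]

lemma IsVirtualPair.add_smul_onePair (hE : IsPolygon x E) (hreg : IsRegular κ x E)
    {P₀ : H1 E →L[ℝ] ℝ} {l : ℕ} {u : H1 E} {g : Plane → ℝ} (h : IsVirtualPair x P₀ l (u, g))
    (a : ℝ) : IsVirtualPair x P₀ l (u + a • (onePair hE hreg).1, g + a • (onePair hE hreg).2) :=
  h.add hE.isOpen hE.isBounded ((isVirtualPair_onePair hE hreg P₀ l).smul a)

/-- The flux functional vanishes on functions whose gradient has zero projection. -/
lemma fluxForm_eq_zero (hE : IsPolygon x E) (hreg : IsRegular κ x E) {P₀ : H1 E →L[ℝ] ℝ}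
    (hP₀ : IsConstProjection P₀) {l : ℕ} (τ : virtualPairs hE hreg P₀ l)
    (hproj : piZero l (grad τ.1.1) = 0) (p : Fin 2 → Poly l) :
    fluxForm hE hreg P₀ l τ p = 0 := by
  obtain ⟨⟨u, g⟩, hg⟩ := τ
  have hg : IsVirtualPair x P₀ l (u, g) := hg
  have hP : P₀ (u + (-P₀ u) • (onePair hE hreg).1) = 0 := by
    rw [map_add, map_smul, hP₀ 1 _ (fn_onePair hE hreg), smul_eq_mul, mul_one, add_neg_cancel]
  have hproj' : piZero l (grad (u + (-P₀ u) • (onePair hE hreg).1)) = 0 := by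
    rw [grad_add_smul_onePair, hproj]
  -- Subtracting `P₀ u` leaves the gradient unchanged. The gradient term vanishes by the projection
  -- hypothesis, the divergence term by orthogonality to `ℙ_{l+1}`.
  rw [fluxForm_apply, (hg.trace.sub_const hE hreg (P₀ u)).flux hE hreg p,
    integral_inner_polyField_eq_zero hE hproj' p, zero_add]
  exact Finset.sum_eq_zero fun j _ => integral_mul_polyFun_eq_zero hE hreg hP₀
    (hg.add_smul_onePair hE hreg (-P₀ u)).enhanced hproj' hP (pderiv_mem_poly (p j).2 j)

/-- The Laplacian lies in `ℙ_{l+1}`, to which `v` is orthogonal, so Green's formula leaves no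
energy. -/
lemma grad_eq_zero_of_trace_zero (hE : IsPolygon x E) (hreg : IsRegular κ x E)
    {P₀ : H1 E →L[ℝ] ℝ} (hP₀ : IsConstProjection P₀) {l : ℕ} {v : H1 E}
    (hv : v ∈ virtualSpace x P₀ l) (htr : IsTrace x v 0) (hP : P₀ v = 0)
    (hproj : piZero l (grad v) = 0) : grad v = 0 := by
  obtain ⟨q, hq, hΔ⟩ := hv.2.1
  have hgreen := integral_grad_sq_of_trace_zero hE hreg htr (continuous_polyFun q) hΔ
  simp only [mul_comm (polyFun q _)] at hgreen
  rw [integral_mul_polyFun_eq_zero hE hreg hP₀ hv.1 hproj hP hq, neg_zero] at hgreen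
  exact inner_self_eq_zero.1 ((L2.inner_def (𝕜 := ℝ) (grad v) (grad v)).trans hgreen)

/-- A function in the virtual element space whose gradient has zero projection is constant on the
vertices. -/
lemma exists_vertexValues_eq (hE : IsPolygon x E) (hreg : IsRegular κ x E)
    {l : ℕ} {P₀ : H1 E →L[ℝ] ℝ} (hP₀ : IsConstProjection P₀)
    (hdof : ∀ v ∈ virtualSpace x P₀ l, IsTrace x v 0 → P₀ v = 0)
    (hl : ((l : ℤ) + 1) * (l + 2) - Module.finrank ℝ (badPoly x P₀ l) ≥ (N : ℤ) - 1)
    (τ : virtualPairs hE hreg P₀ l) (hproj : piZero l (grad τ.1.1) = 0) :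
    ∃ d : ℝ, ∀ i, vertexValues hE hreg P₀ l τ i = d := by
  have hev : vertexValues hE hreg P₀ l (oneVirtual hE hreg P₀ l) ≠ 0 := by
    intro h
    have h0 := congrFun h (⟨0, by linarith [hE.three_le]⟩ : Fin N)
    rw [vertexValues_oneVirtual, Pi.zero_apply] at h0
    exact one_ne_zero h0
  have hdim : (N : ℤ) - 1 ≤ Module.finrank ℝ (Fin 2 → Poly l) -
      Module.finrank ℝ (badPoly x P₀ l) := by
    rw [finrank_polyField]
    push_cast
    exact hl
  obtain ⟨d, hd⟩ := exists_smul_of_functional_eq_zero (fluxForm hE hreg P₀ l)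
    (vertexValues hE hreg P₀ l) (fluxForm_eq_zero_of_vertexValues_eq_zero hE hreg hdof) hev
    (fluxForm_oneVirtual hE hreg hP₀ l) (fun _ => mem_badPoly_of_fluxForm hE hreg) hdim
    (fluxForm_eq_zero hE hreg hP₀ τ hproj)
  refine ⟨d, fun i => ?_⟩
  have hi := congrFun hd i
  rwa [Pi.smul_apply, vertexValues_oneVirtual, smul_eq_mul, mul_one] at hi

end

/-! ### Conclusion -/

theorem grad_eq_zero_of_piZero_grad_eq_zero {N : ℕ} {x : Fin N → Plane} {E : Set Plane}
    (hE : IsPolygon x E) {κ : ℝ} (hreg : IsRegular κ x E) {l : ℕ} {P₀ : H1 E →L[ℝ] ℝ}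
    (hP₀ : IsConstProjection P₀) (hdof : ∀ v ∈ virtualSpace x P₀ l, IsTrace x v 0 → P₀ v = 0)
    (hl : ((l : ℤ) + 1) * (l + 2) - Module.finrank ℝ (badPoly x P₀ l) ≥ (N : ℤ) - 1)
    {u : H1 E} (hu : u ∈ virtualSpace x P₀ l) (hproj : piZero l (grad u) = 0) : grad u = 0 := by
  obtain ⟨g, hg⟩ := mem_virtualSpace_iff.1 hu
  obtain ⟨d, hd⟩ := exists_vertexValues_eq hE hreg hP₀ hdof hl ⟨(u, g), hg⟩ hproj
  -- Subtract the common vertex value, not `P₀ u`: this makes the trace zero, and `hdof` then shows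
  -- that the difference also has zero `P₀`.
  have hpair := hg.add_smul_onePair hE hreg (-d)
  have hmem := mem_virtualSpace_iff.2 ⟨_, hpair⟩
  have htr : IsTrace x (u + (-d) • (onePair hE hreg).1) 0 := hpair.trace_zero fun i => by
    change g (x i) + -d * 1 = 0
    rw [show g (x i) = d from hd i, mul_one, add_neg_cancel]
  rw [← grad_add_smul_onePair hE hreg u (-d)] at hproj ⊢
  exact grad_eq_zero_of_trace_zero hE hreg hP₀ hmem htr (hdof _ hmem htr) hproj

end E2VEM

end

theorem mainTheorem1 {N : ℕ} (x : Fin N → E2VEM.Plane) (E : Set E2VEM.Plane)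
    (hE : E2VEM.IsPolygon x E) (κ : ℝ) (hκ : 0 < κ) (hreg : E2VEM.IsRegular κ x E)
    (l : ℕ) (P₀ : E2VEM.H1 E →L[ℝ] ℝ) (hP₀ : E2VEM.IsConstProjection P₀)
    (hdof : ∀ v ∈ E2VEM.virtualSpace x P₀ l, E2VEM.IsTrace x v 0 → P₀ v = 0)
    (hl : ((l : ℤ) + 1) * (l + 2) - Module.finrank ℝ (E2VEM.badPoly x P₀ l) ≥ (N : ℤ) - 1)
    (u : E2VEM.H1 E) (hu : u ∈ E2VEM.virtualSpace x P₀ l)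
    (hproj : E2VEM.piZero l (E2VEM.grad u) = 0) :
    E2VEM.grad u = 0 := by
  exact E2VEM.grad_eq_zero_of_piZero_grad_eq_zero hE hreg hP₀ hdof hl hu hproj
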